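/- Finite binary strings are the elements of $\{0,1\}^*$, and $|p|$ is the length of $p$. A computer is a partial recursive function $C\colon\{0,1\}^*\to\{0,1\}^*$ whose domain $\mathrm{Dom}\,C$ is prefix-free, i.e. no string in it is a prefix of another string in it. A computer $U$ is optimal if for every computer $C$ there is a constant $\mathrm{sim}(C)\in\mathbb{N}$ such that whenever $C(p)$ is defined there is $p'$ with $U(p')=C(p)$ and $|p'|\le|p|+\mathrm{sim}(C)$. Let $U$ be any optimal computer, put $H(s)=\min\{|p| : U(p)=s\}$ for $s\in\{0,1\}^*$, and for real $Q>0$ and $0<D<1$ let $$W(Q,D)=\sum_{p\in\mathrm{Dom}\,U}|p|^{Q}\,2^{-|p|/D}$$ (this series converges). A real $x$ is computable if there is a total recursive $f\colon\mathbb{N}^+\to\mathbb{Q}$ with $|x-f(n)|<1/n$ for all $n\in\mathbb{N}^+$; it is right-computable if there is a total recursive $g\colon\mathbb{N}^+\to\mathbb{Q}$ with $x\le g(n)$ for all $n\in\mathbb{N}^+$ and $\lim_{n\to\infty}g(n)=x$; it is left-computable if $-x$ is right-computable. For real $x$, $x_n$ denotes the string of the first $n$ bits of the base-two expansion of $x-\lfloor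 x\rfloor$ with infinitely many zeros. **Theorem.** Let $Q$ be a computable real number with $Q>0$. For every $T\in(0,1)$, if $W(Q,T)$ is a computable real number, then the following hold: 1. $T$ is right-computable and not left-computable. 2. $T$ is Chaitin $T$-random, i.e. $\lim_{n\to\infty}\bigl(H(T_n)-Tn\bigr)=\infty$, and $T$-compressible, i.e. there is $e\colon\mathbb{N}^+\to\mathbb{R}$ with $\lim_{n\to\infty}e(n)/n=0$ and $H(T_n)\le Tn+e(n)$ for all $n\in\mathbb{N}^+$. -/

import Mathlib

open Filter Asymptotics

namespace AIT

/-! ### Computable, right-computable and left-computable real numbers -/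

/-- A sequence of rationals is recursive if numerator (a difference of two naturals) and
nonzero denominator can be given by total recursive functions. -/
def RecursiveRatSeq (f : ℕ → ℚ) : Prop :=
  ∃ a b c : ℕ → ℕ, Computable a ∧ Computable b ∧ Computable c ∧
    ∀ n, f n = ((a n : ℚ) - (b n : ℚ)) / ((c n : ℚ) + 1)

/-- A computable real number. The index ranges over the positive integers; the value of `f` at `0`
is irrelevant. -/
def ComputableReal (x : ℝ) : Prop :=
  ∃ f : ℕ → ℚ, RecursiveRatSeq f ∧ ∀ n : ℕ, 1 ≤ n → |x - (f n : ℝ)| < 1 / (n : ℝ)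

/-- A right-computable real number. -/
def RightComputable (x : ℝ) : Prop :=
  ∃ g : ℕ → ℚ, RecursiveRatSeq g ∧ (∀ n : ℕ, 1 ≤ n → x ≤ (g n : ℝ)) ∧
    Tendsto (fun n => (g n : ℝ)) atTop (nhds x)

/-- A left-computable real number. -/
def LeftComputable (x : ℝ) : Prop := RightComputable (-x)

/-! ### Computers and program-size complexity -/

/-- No string of `S` is a prefix of another string of `S`. -/
def PrefixFree (S : Set (List Bool)) : Prop :=
  ∀ p ∈ S, ∀ q ∈ S, p <+: q → p = q

/-- A computer: a partial recursive function on finite binary strings with prefix-free domain. -/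
def IsComputer (C : List Bool →. List Bool) : Prop :=
  Partrec C ∧ PrefixFree C.Dom

/-- A computer that simulates every computer up to an additive constant in the program length. -/
def IsOptimal (U : List Bool →. List Bool) : Prop :=
  IsComputer U ∧ ∀ C : List Bool →. List Bool, IsComputer C →
    ∃ sim : ℕ, ∀ p s : List Bool, s ∈ C p →
      ∃ p' : List Bool, s ∈ U p' ∧ p'.length ≤ p.length + sim

/-- Program-size complexity `H_C(s)`: the least length of a program for `s`. (For optimal `C` every
`s` has a program, so the infimum is a minimum.) -/
noncomputable def H (C : List Bool →. List Bool) (s : List Bool) : ℕ :=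
  sInf {l : ℕ | ∃ p : List Bool, s ∈ C p ∧ p.length = l}

/-- `W(Q, D) = ∑_{p ∈ Dom U} |p|^Q 2^{-|p|/D}`. For a prefix-free domain and `0 < D < 1` this
series of nonnegative terms converges. -/
noncomputable def W (U : List Bool →. List Bool) (Q D : ℝ) : ℝ :=
  ∑' p : U.Dom, ((p : List Bool).length : ℝ) ^ Q *
    (2 : ℝ) ^ (-((p : List Bool).length : ℝ) / D)

/-! ### Infinite binary strings -/

/-- The infinite binary string of a real `x`: the base-two expansion of `x mod 1` with infinitely
many zeros, whose digit number `i` (counted from `0`) is `⌊(x mod 1) * 2 ^ (i + 1)⌋ mod 2`. -/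
noncomputable def binary (x : ℝ) (i : ℕ) : Bool :=
  decide (Real.digits (Int.fract x) 2 i = 1)

/-- The first `n` bits of an infinite binary string. -/
def firstBits (α : ℕ → Bool) (n : ℕ) : List Bool := (List.range n).map α

/-- Chaitin `D`-randomness (relative to the optimal computer `U`):
`H(α_n) - D n` tends to infinity. -/
def ChaitinRandom (U : List Bool →. List Bool) (D : ℝ) (α : ℕ → Bool) : Prop :=
  Tendsto (fun n : ℕ => (H U (firstBits α n) : ℝ) - D * (n : ℝ)) atTop atTop

/-- `D`-compressibility (relative to the optimal computer `U`): `H(α_n) ≤ D n + o(n)`. -/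
def Compressible (U : List Bool →. List Bool) (D : ℝ) (α : ℕ → Bool) : Prop :=
  ∃ e : ℕ → ℝ, (e =o[atTop] fun n : ℕ => (n : ℝ)) ∧
    ∀ n : ℕ, 1 ≤ n → (H U (firstBits α n) : ℝ) ≤ D * (n : ℝ) + e n

end AIT

/-! Write w = W(Q,T). The map D ↦ W(Q,D) is strictly increasing on (0,1) and is a supremum of finite
sums over halting programs. So a rational r in (0,1) exceeds T exactly when some finite sum taken at
r exceeds w. As Q and w are computable, this condition is recursively enumerable, which makes T
right-computable (`IsOptimal.sigmaOne_gt_of_computableReal_W`).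

Randomness (`IsOptimal.chaitinRandom`): T_n yields a dyadic t > T with t - T ≤ 2^(-n). Search for a
finite set F of halting programs whose sum at t exceeds w. Finite sums are Lipschitz in D with a
common constant, so the sum of F at T exceeds w - C 2^(-n), and every program p outside F satisfies
|p|^Q 2^(-|p|/T) < C 2^(-n). Logarithms give |p| - Tn ≥ TQ log₂|p| - O(1), which tends to infinity
because Q > 0. A string longer than all outputs of F is computable from T_n, and its shortest
program lies outside F.

Compressibility (`IsOptimal.exists_H_firstBits_le`): fix a rational r in (T,1). About rn bits of the
halting probability yield a finite F whose complement has measure at most 2^(-rn). The complement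
then contributes only O(2^(-rn/T')) to w, for some T' in (T,r), and this is o(2^(-n)). Comparing the
finite sums of F at dyadic points with w therefore locates T up to one unit in the n-th place. Hence
H(T_n) ≤ rn + o(n), and r may approach T.

If T were also left-computable, T_n would be computable from n alone up to one unit, so H(T_n) would
be o(n), against randomness (`IsOptimal.not_leftComputable`).

Every search is phrased as a `SigmaOne` predicate; `SigmaOne.exists_partrec` turns it into a partial
recursive function. -/

namespace AIT

/-! ### Closure properties of recursively enumerable predicates. -/

section Recursion

variable {α β γ σ : Type*} [Primcodable α] [Primcodable β] [Primcodable γ] [Primcodable σ]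

attribute [fun_prop] Primrec

@[fun_prop] theorem primrec_id : Primrec fun a : α => a := Primrec.id
@[fun_prop] theorem primrec_const (b : β) : Primrec fun _ : α => b := Primrec.const b
@[fun_prop] theorem primrec_comp {f : β → σ} {g : α → β} (hf : Primrec f) (hg : Primrec g) :
    Primrec fun a => f (g a) := hf.comp hg
@[fun_prop] theorem primrec_mk {f : α → β} {g : α → γ} (hf : Primrec f) (hg : Primrec g) :
    Primrec fun a => (f a, g a) := hf.pair hg
@[fun_prop] theorem primrec_fst {f : α → β × γ} (hf : Primrec f) : Primrec fun a => (f a).1 :=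
  Primrec.fst.comp hf
@[fun_prop] theorem primrec_snd {f : α → β × γ} (hf : Primrec f) : Primrec fun a => (f a).2 :=
  Primrec.snd.comp hf
@[fun_prop] theorem primrec_add {f g : α → ℕ} (hf : Primrec f) (hg : Primrec g) :
    Primrec fun a => f a + g a := Primrec.nat_add.comp hf hg
@[fun_prop] theorem primrec_sub {f g : α → ℕ} (hf : Primrec f) (hg : Primrec g) :
    Primrec fun a => f a - g a := Primrec.nat_sub.comp hf hg
@[fun_prop] theorem primrec_mul {f g : α → ℕ} (hf : Primrec f) (hg : Primrec g) :
    Primrec fun a => f a * g a := Primrec.nat_mul.comp hf hg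
@[fun_prop] theorem primrec_div {f g : α → ℕ} (hf : Primrec f) (hg : Primrec g) :
    Primrec fun a => f a / g a := Primrec.nat_div.comp hf hg
@[fun_prop] theorem primrec_mod {f g : α → ℕ} (hf : Primrec f) (hg : Primrec g) :
    Primrec fun a => f a % g a := Primrec.nat_mod.comp hf hg
@[fun_prop] theorem primrec_pow {f g : α → ℕ} (hf : Primrec f) (hg : Primrec g) :
    Primrec fun a => f a ^ g a :=
  (Primrec₂.unpaired'.1 Nat.Primrec.pow).comp hf hg
@[fun_prop] theorem primrec_length {f : α → List β} (hf : Primrec f) :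
    Primrec fun a => (f a).length := Primrec.list_length.comp hf
@[fun_prop] theorem primrec_encode {f : α → β} (hf : Primrec f) :
    Primrec fun a => Encodable.encode (f a) := Primrec.encode.comp hf
@[fun_prop] theorem primrec_cons {f : α → β} {g : α → List β} (hf : Primrec f) (hg : Primrec g) :
    Primrec fun a => f a :: g a := Primrec.list_cons.comp hf hg
@[fun_prop] theorem primrec_append {f g : α → List β} (hf : Primrec f) (hg : Primrec g) :
    Primrec fun a => f a ++ g a := Primrec.list_append.comp hf hg
@[fun_prop] theorem primrec_flatten {f : α → List (List β)} (hf : Primrec f) :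
    Primrec fun a => (f a).flatten := Primrec.list_flatten.comp hf

theorem primrec_map_fst : Primrec fun l : List (β × γ) => l.map Prod.fst :=
  Primrec.list_map Primrec.id (Primrec.fst.comp Primrec.snd)

theorem primrec_map_snd : Primrec fun l : List (β × γ) => l.map Prod.snd :=
  Primrec.list_map Primrec.id (Primrec.snd.comp Primrec.snd)

@[fun_prop] theorem primrec_list_map_fst {f : α → List (β × γ)} (hf : Primrec f) :
    Primrec fun a => (f a).map Prod.fst := primrec_map_fst.comp hf
@[fun_prop] theorem primrec_list_map_snd {f : α → List (β × γ)} (hf : Primrec f) :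
    Primrec fun a => (f a).map Prod.snd := primrec_map_snd.comp hf

@[fun_prop] theorem primrec_list_sum {f : α → List ℕ} (hf : Primrec f) :
    Primrec fun a => (f a).sum :=
  (Primrec.list_foldr hf (Primrec.const 0)
    (Primrec.nat_add.comp (Primrec.fst.comp Primrec.snd) (Primrec.snd.comp Primrec.snd)).to₂).of_eq
    fun a => (List.sum_eq_foldr (l := f a)).symm

@[fun_prop] theorem primrec_replicate {f : α → ℕ} {g : α → β} (hf : Primrec f) (hg : Primrec g) :
    Primrec fun a => List.replicate (f a) (g a) :=
  (Primrec.list_map (Primrec.list_range.comp hf) (hg.comp Primrec.fst).to₂).of_eq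
    fun a => by simp

/-- Predicates of the form `∃ n, R a n` with `R` primitive recursive, i.e. recursively enumerable
predicates in normal form. -/
def SigmaOne (p : α → Prop) : Prop :=
  ∃ R : α → ℕ → Prop, PrimrecRel R ∧ ∀ a, p a ↔ ∃ n, R a n

namespace SigmaOne

theorem of_iff {p q : α → Prop} (hp : SigmaOne p) (h : ∀ a, q a ↔ p a) : SigmaOne q := by
  obtain ⟨R, hR, hp⟩ := hp
  exact ⟨R, hR, fun a => (h a).trans (hp a)⟩

theorem of_primrecPred {p : α → Prop} (hp : PrimrecPred p) : SigmaOne p :=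
  ⟨fun a _ => p a, hp.comp Primrec.fst, fun a => by simp⟩

theorem comp {p : β → Prop} {f : α → β} (hp : SigmaOne p) (hf : Primrec f) :
    SigmaOne fun a => p (f a) := by
  obtain ⟨R, hR, hp⟩ := hp
  exact ⟨fun a n => R (f a) n, hR.comp (hf.comp Primrec.fst) Primrec.snd, fun a => hp _⟩

theorem lt {f g : α → ℕ} (hf : Primrec f) (hg : Primrec g) : SigmaOne fun a => f a < g a :=
  of_primrecPred (Primrec.nat_lt.comp hf hg)

theorem le {f g : α → ℕ} (hf : Primrec f) (hg : Primrec g) : SigmaOne fun a => f a ≤ g a :=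
  of_primrecPred (Primrec.nat_le.comp hf hg)

theorem eq {f g : α → β} (hf : Primrec f) (hg : Primrec g) : SigmaOne fun a => f a = g a :=
  of_primrecPred (Primrec.eq.comp hf hg)

theorem and {p q : α → Prop} (hp : SigmaOne p) (hq : SigmaOne q) :
    SigmaOne fun a => p a ∧ q a := by
  obtain ⟨R, hR, hp⟩ := hp
  obtain ⟨S, hS, hq⟩ := hq
  refine ⟨fun a n => R a n.unpair.1 ∧ S a n.unpair.2, PrimrecPred.and
    (hR.comp Primrec.fst (Primrec.fst.comp (Primrec.unpair.comp Primrec.snd)))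
    (hS.comp Primrec.fst (Primrec.snd.comp (Primrec.unpair.comp Primrec.snd))), fun a => ?_⟩
  simp only [hp, hq]
  constructor
  · rintro ⟨⟨m, hm⟩, n, hn⟩
    exact ⟨Nat.pair m n, by simpa using ⟨hm, hn⟩⟩
  · rintro ⟨n, h1, h2⟩
    exact ⟨⟨_, h1⟩, _, h2⟩

theorem ex {p : α → β → Prop} (hp : SigmaOne fun x : α × β => p x.1 x.2) :
    SigmaOne fun a => ∃ b, p a b := by
  obtain ⟨R, hR, hp⟩ := hp
  have hS : PrimrecPred fun y : (α × ℕ) × β => R (y.1.1, y.2) y.1.2.unpair.2 :=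
    hR.comp (by fun_prop) (Primrec.snd.comp (Primrec.unpair.comp (by fun_prop)))
  have hd : Primrec fun y : α × ℕ => Encodable.decode (α := β) y.2.unpair.1 :=
    Primrec.decode.comp (Primrec.fst.comp (Primrec.unpair.comp Primrec.snd))
  -- The index n codes both the witness b and its certificate; reading the decoded option as a list
  -- of length at most one keeps the quantifier over b bounded.
  refine ⟨fun a n => ∃ b ∈ (Encodable.decode (α := β) n.unpair.1).toList, R (a, b) n.unpair.2,
    ?_, fun a => ?_⟩
  · exact (PrimrecRel.exists_mem_list (R := fun b (y : α × ℕ) => R (y.1, b) y.2.unpair.2)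
      (hS.comp (Primrec.snd.pair Primrec.fst))).comp (Primrec.optionToList.comp hd) Primrec.id
  · constructor
    · rintro ⟨b, hb⟩
      obtain ⟨n, hn⟩ := (hp (a, b)).1 hb
      exact ⟨Nat.pair (Encodable.encode b) n, b, by simp, by simpa using hn⟩
    · rintro ⟨n, b, -, hb⟩
      exact ⟨b, (hp (a, b)).2 ⟨_, hb⟩⟩

theorem forall_mem {p : α → β → Prop} (hp : SigmaOne fun x : α × β => p x.1 x.2)
    {f : α → List β} (hf : Primrec f) : SigmaOne fun a => ∀ b ∈ f a, p a b := by
  obtain ⟨R, hR, hp⟩ := hp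
  have hS : PrimrecRel fun (n : ℕ) (y : α × β) => ∃ m < n, R y m :=
    ((PrimrecRel.exists_mem_list (R := fun m y => R y m) hR.swap).comp
      (Primrec.list_range.comp Primrec.fst) Primrec.snd).of_eq fun z => by simp
  have hT : PrimrecRel fun (b : β) (y : α × ℕ) => ∃ m < y.2, R (y.1, b) m :=
    hS.comp (f := fun z : β × α × ℕ => z.2.2) (g := fun z => (z.2.1, z.1))
      (by fun_prop) (by fun_prop)
  refine ⟨fun a n => ∀ b ∈ f a, ∃ m < n, R (a, b) m,
    hT.forall_mem_list.comp (hf.comp Primrec.fst) Primrec.id, fun a => ?_⟩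
  constructor
  · intro h
    have h' : ∀ b, ∃ n, b ∈ f a → R (a, b) n := fun b => by
      by_cases hb : b ∈ f a
      · obtain ⟨n, hn⟩ := (hp (a, b)).1 (h b hb)
        exact ⟨n, fun _ => hn⟩
      · exact ⟨0, fun hb' => absurd hb' hb⟩
    choose k hk using h'
    -- The sum of the individual certificates serves as a common bound for all of them.
    refine ⟨((f a).map k).sum + 1, fun b hb => ⟨k b, Nat.lt_succ_of_le ?_, hk b hb⟩⟩
    exact List.single_le_sum (by simp) _ (List.mem_map_of_mem hb)
  · rintro ⟨n, hn⟩ b hb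
    obtain ⟨m, -, hm⟩ := hn b hb
    exact (hp (a, b)).2 ⟨m, hm⟩

/-- Kleene's normal form: a value is attained when some step-bounded evaluation of a code returns
it, and bounded evaluation is primitive recursive. -/
theorem of_partrec {f : α →. σ} (hf : Partrec f) : SigmaOne fun x : α × σ => x.2 ∈ f x.1 := by
  obtain ⟨c, hc⟩ := Nat.Partrec.Code.exists_code.1 hf
  refine ⟨fun x k => Nat.Partrec.Code.evaln k c (Encodable.encode x.1)
      = some (Encodable.encode x.2),
    Primrec.eq.comp (Nat.Partrec.Code.primrec_evaln.comp
      (f := fun a : (ℕ × Nat.Partrec.Code) × ℕ => Nat.Partrec.Code.evaln a.1.1 a.1.2 a.2)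
      (g := fun y : (α × σ) × ℕ => ((y.2, c), Encodable.encode y.1.1)) (by fun_prop))
      (Primrec.option_some.comp (by fun_prop)), fun x => ?_⟩
  have := Nat.Partrec.Code.evaln_complete (c := c) (n := Encodable.encode x.1)
    (x := Encodable.encode x.2)
  simp only [Option.mem_def] at this
  rw [← this, hc]
  simp

/-- A recursively enumerable relation has a partial recursive choice function. -/
theorem exists_partrec {p : α → β → Prop} (hp : SigmaOne fun x : α × β => p x.1 x.2) :
    ∃ f : α →. β, Partrec f ∧ (∀ a, ∀ b ∈ f a, p a b) ∧ ∀ a, (∃ b, p a b) → (f a).Dom := by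
  classical
  obtain ⟨R, hR, hp⟩ := hp
  have hd : Primrec fun y : α × ℕ => Encodable.decode (α := β) y.2.unpair.1 :=
    Primrec.decode.comp (Primrec.fst.comp (Primrec.unpair.comp Primrec.snd))
  let g : α → ℕ → Option β := fun a n =>
    (Encodable.decode (α := β) n.unpair.1).bind fun b =>
      if R (a, b) n.unpair.2 then some b else none
  have hg : Primrec₂ g := by
    refine Primrec.option_bind hd (Primrec.ite ?_ ?_ ?_)
    · exact hR.comp (by fun_prop) (Primrec.snd.comp (Primrec.unpair.comp (by fun_prop)))
    · exact Primrec.option_some.comp Primrec.snd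
    · fun_prop
  refine ⟨fun a => Nat.rfindOpt (g a), Partrec.rfindOpt hg.to_comp, fun a b hb => ?_, ?_⟩
  · obtain ⟨n, hn⟩ := Nat.rfindOpt_spec hb
    simp only [g, Option.mem_def, Option.bind_eq_some_iff] at hn
    obtain ⟨b', -, hb'⟩ := hn
    split_ifs at hb' with h
    · cases hb'
      exact (hp (a, b)).2 ⟨_, h⟩
  · rintro a ⟨b, hb⟩
    obtain ⟨n, hn⟩ := (hp (a, b)).1 hb
    refine Nat.rfindOpt_dom.2 ⟨Nat.pair (Encodable.encode b) n, b, ?_⟩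
    simp [g, hn]

theorem of_computable {f : α → σ} (hf : Computable f) : SigmaOne fun x : α × σ => x.2 = f x.1 :=
  (of_partrec hf.partrec).of_iff fun x => by simp

end SigmaOne

end Recursion

/-! ### Binary strings as naturals; prefixes of the expansion of T. -/

section BinaryValue

/-- The natural number with a given binary expansion, most significant bit first. -/
def binVal (l : List Bool) : ℕ := l.foldl (fun n b => 2 * n + b.toNat) 0

@[simp] theorem binVal_nil : binVal [] = 0 := rfl

@[simp] theorem binVal_concat (l : List Bool) (b : Bool) :
    binVal (l ++ [b]) = 2 * binVal l + b.toNat := by simp [binVal]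

theorem primrec_binVal : Primrec binVal :=
  Primrec.list_foldl Primrec.id (Primrec.const 0)
    (primrec_add (primrec_mul (Primrec.const 2) (Primrec.fst.comp Primrec.snd))
      ((Primrec.dom_bool Bool.toNat).comp (Primrec.snd.comp Primrec.snd))).to₂

@[fun_prop] theorem primrec_binVal_comp {α : Type*} [Primcodable α] {f : α → List Bool}
    (hf : Primrec f) : Primrec fun a => binVal (f a) := primrec_binVal.comp hf

theorem binVal_injective : ∀ {l l' : List Bool}, l.length = l'.length → binVal l = binVal l' →
    l = l' := by
  intro l
  induction l using List.reverseRecOn with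
  | nil => intro l' h _; exact (List.length_eq_zero_iff.1 h.symm).symm
  | append_singleton l b ih =>
    intro l' h hv
    rcases List.eq_nil_or_concat l' with rfl | ⟨l', b', rfl⟩
    · simp at h
    · simp only [List.concat_eq_append, binVal_concat, List.length_append, List.length_singleton,
        Nat.add_right_cancel_iff] at h hv ⊢
      have h1 : b.toNat < 2 := Bool.toNat_lt b
      have h2 : b'.toNat < 2 := Bool.toNat_lt b'
      have hb : b.toNat = b'.toNat := by omega
      have hl : l = l' := ih h (by omega)
      have : b = b' := by revert hb; cases b <;> cases b' <;> simp
      rw [hl, this]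

theorem exists_binVal_eq : ∀ {n i : ℕ}, i < 2 ^ n → ∃ l : List Bool, l.length = n ∧ binVal l = i
  | 0, i, h => ⟨[], rfl, by simp at h; simp [h]⟩
  | n + 1, i, h => by
    obtain ⟨l, hl, hv⟩ := exists_binVal_eq (n := n) (i := i / 2) (by rw [pow_succ] at h; omega)
    refine ⟨l ++ [decide (i % 2 = 1)], by simp [hl], ?_⟩
    rw [binVal_concat, hv]
    rcases Nat.mod_two_eq_zero_or_one i with h0 | h0 <;> simp [h0] <;> omega

@[simp] theorem length_firstBits (α : ℕ → Bool) (n : ℕ) : (firstBits α n).length = n := by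
  simp [firstBits]

theorem firstBits_succ (α : ℕ → Bool) (n : ℕ) :
    firstBits α (n + 1) = firstBits α n ++ [α n] := by
  simp [firstBits, List.range_succ]

theorem binVal_firstBits {T : ℝ} (h0 : 0 ≤ T) (h1 : T < 1) (n : ℕ) :
    binVal (firstBits (binary T) n) = ⌊T * 2 ^ n⌋₊ := by
  induction n with
  | zero => simp [firstBits, Nat.floor_eq_zero.2 h1]
  | succ n ih =>
    have hfr : Int.fract T = T := Int.fract_eq_self.2 ⟨h0, h1⟩
    have hdiv : ⌊T * 2 ^ n⌋₊ = ⌊T * 2 ^ (n + 1)⌋₊ / 2 := by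
      rw [← Nat.floor_div_ofNat, pow_succ]
      congr 1
      ring
    have hbit : (binary T n).toNat = ⌊T * 2 ^ (n + 1)⌋₊ % 2 := by
      simp only [binary, hfr, Real.digits, Fin.ext_iff, Fin.ofNat, Nat.cast_ofNat]
      rcases Nat.mod_two_eq_zero_or_one ⌊T * 2 ^ (n + 1)⌋₊ with h | h <;> simp [h]
    rw [firstBits_succ, binVal_concat, ih, hbit, hdiv]
    omega

end BinaryValue

/-! ### Program-size complexity, self-delimiting codes and Kraft's inequality. -/

section Complexity

variable {U : List Bool →. List Bool}

theorem H_le {p s : List Bool} (h : s ∈ U p) : H U s ≤ p.length :=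
  Nat.sInf_le ⟨p, h, rfl⟩

theorem exists_length_eq_H {p s : List Bool} (h : s ∈ U p) :
    ∃ q, s ∈ U q ∧ q.length = H U s :=
  Nat.sInf_mem (s := {l : ℕ | ∃ p : List Bool, s ∈ U p ∧ p.length = l}) ⟨_, p, h, rfl⟩

theorem mem_dom {p s : List Bool} (h : s ∈ U p) : p ∈ U.Dom := (PFun.mem_dom _ _).2 ⟨s, h⟩

/-- Postprocessing the output can only shrink the domain, and prefix-freeness passes to subsets. -/
theorem IsComputer.bind (hU : IsComputer U) {ψ : List Bool →. List Bool} (hψ : Partrec ψ) :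
    IsComputer fun p => (U p).bind ψ := by
  refine ⟨hU.1.bind (hψ.comp Computable.snd).to₂, fun p hp q hq h => ?_⟩
  have hdom : ∀ p : List Bool, p ∈ PFun.Dom (fun p => (U p).bind ψ) → p ∈ U.Dom := fun p hp => by
    obtain ⟨s, hs⟩ := (PFun.mem_dom _ _).1 hp
    obtain ⟨t, ht, -⟩ := Part.mem_bind_iff.1 hs
    exact mem_dom ht
  exact hU.2 p (hdom p hp) q (hdom q hq) h

/-- A partial recursive transformation increases the program-size complexity by at most a
constant. -/
theorem IsOptimal.exists_H_le_add (hU : IsOptimal U) {ψ : List Bool →. List Bool}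
    (hψ : Partrec ψ) :
    ∃ c : ℕ, ∀ p s t, s ∈ U p → t ∈ ψ s → H U t ≤ H U s + c := by
  obtain ⟨c, hc⟩ := hU.2 _ (hU.1.bind hψ)
  refine ⟨c, fun p s t hs ht => ?_⟩
  obtain ⟨q, hq, hl⟩ := exists_length_eq_H hs
  obtain ⟨p', hp', hl'⟩ := hc q t (Part.mem_bind_iff.2 ⟨s, hq, ht⟩)
  exact (H_le hp').trans (hl'.trans_eq (by rw [hl]))

/-- A self-delimiting code of `n` in about `n / K` bits, followed by the raw string `x`. -/
def blockCode (K n : ℕ) (x : List Bool) : List Bool :=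
  List.replicate (n / K) false ++ true :: (List.replicate (n % K) false ++ true :: x)

theorem replicate_append_isPrefix : ∀ {a b : ℕ} {u v : List Bool},
    List.replicate a false ++ true :: u <+: List.replicate b false ++ true :: v →
      a = b ∧ u <+: v
  | 0, 0, u, v, h => ⟨rfl, by simpa using h⟩
  | 0, b + 1, u, v, h => by simp [List.replicate_succ, List.cons_prefix_cons] at h
  | a + 1, 0, u, v, h => by simp [List.replicate_succ, List.cons_prefix_cons] at h
  | a + 1, b + 1, u, v, h => by
    simp only [List.replicate_succ, List.cons_append, List.cons_prefix_cons, true_and] at h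
    obtain ⟨h1, h2⟩ := replicate_append_isPrefix h
    exact ⟨by rw [h1], h2⟩

theorem blockCode_isPrefix {K n n' : ℕ} {x x' : List Bool}
    (h : blockCode K n x <+: blockCode K n' x') : n = n' ∧ x <+: x' := by
  obtain ⟨h1, h2⟩ := replicate_append_isPrefix h
  obtain ⟨h3, h4⟩ := replicate_append_isPrefix h2
  exact ⟨by rw [← Nat.div_add_mod n K, h1, h3, Nat.div_add_mod], h4⟩

/-- A machine can read n from its self-delimiting code and then knows that exactly m n raw bits
follow, so its domain is prefix-free. The overhead n / K is crude compared with log n, but K is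
arbitrary and only an o(n) error is needed. -/
theorem IsOptimal.exists_program_length_le (hU : IsOptimal U) {m : ℕ → ℕ} (hm : Primrec m)
    {K : ℕ} (hK : 0 < K) {φ : ℕ × List Bool →. List Bool} (hφ : Partrec φ) :
    ∃ c : ℕ, ∀ n x s, x.length = m n → s ∈ φ (n, x) →
      ∃ p, s ∈ U p ∧ p.length ≤ m n + n / K + c := by
  have hrel : SigmaOne fun y : List Bool × ℕ × List Bool =>
      y.1 = blockCode K y.2.1 y.2.2 ∧ y.2.2.length = m y.2.1 := by
    unfold blockCode
    exact (SigmaOne.eq (by fun_prop) (by fun_prop)).and (SigmaOne.eq (by fun_prop) (by fun_prop))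
  obtain ⟨d, hd, hdp, hdd⟩ := SigmaOne.exists_partrec
    (p := fun (p : List Bool) (y : ℕ × List Bool) => p = blockCode K y.1 y.2 ∧ y.2.length = m y.1)
    hrel
  have hC : IsComputer fun p => (d p).bind φ := by
    refine ⟨hd.bind (hφ.comp Computable.snd).to₂, fun p hp q hq h => ?_⟩
    obtain ⟨s, hs⟩ := (PFun.mem_dom _ _).1 hp
    obtain ⟨t, ht⟩ := (PFun.mem_dom _ _).1 hq
    obtain ⟨⟨n, x⟩, hx, -⟩ := Part.mem_bind_iff.1 hs
    obtain ⟨⟨n', x'⟩, hx', -⟩ := Part.mem_bind_iff.1 ht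
    obtain ⟨rfl, hl⟩ := hdp _ _ hx
    obtain ⟨rfl, hl'⟩ := hdp _ _ hx'
    obtain ⟨h1, h2⟩ := blockCode_isPrefix h
    simp only at h1 hl hl'
    subst h1
    rw [h2.eq_of_length (hl.trans hl'.symm)]
  obtain ⟨c, hc⟩ := hU.2 _ hC
  -- Besides n / K and the raw bits, the code spends n % K < K zeros and two separators.
  refine ⟨K + 2 + c, fun n x s hx hs => ?_⟩
  obtain ⟨⟨n', x'⟩, hy⟩ := Part.dom_iff_mem.1 (hdd (blockCode K n x) ⟨(n, x), rfl, hx⟩)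
  obtain ⟨h1, h2⟩ := hdp _ _ hy
  obtain ⟨h3, h4⟩ := blockCode_isPrefix ⟨[], (List.append_nil _).trans h1⟩
  simp only at h2 h3 h4
  subst h3
  rw [← h4.eq_of_length (hx.trans h2.symm)] at hy
  obtain ⟨p', hp', hl⟩ := hc (blockCode K n x) s (Part.mem_bind_iff.2 ⟨(n, x), hy, hs⟩)
  refine ⟨p', hp', hl.trans ?_⟩
  have := Nat.mod_lt n hK
  simp only [blockCode, List.length_append, List.length_replicate, List.length_cons, hx]
  omega

theorem IsOptimal.exists_program (hU : IsOptimal U) (s : List Bool) : ∃ p, s ∈ U p := by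
  obtain ⟨c, hc⟩ := hU.exists_program_length_le (m := fun n => n) (by fun_prop) one_pos
    (φ := fun y => Part.some y.2) Computable.snd.partrec
  obtain ⟨p, hp, -⟩ := hc s.length s s rfl (Part.mem_some _)
  exact ⟨p, hp⟩

/-- The empty string is a prefix of everything, so as a program it would be the only one, whereas U
produces every string. Consequently all program lengths are positive and so are all weights. -/
theorem IsOptimal.nil_notMem_dom (hU : IsOptimal U) : [] ∉ U.Dom := by
  intro h
  obtain ⟨p, hp⟩ := hU.exists_program []
  obtain ⟨q, hq⟩ := hU.exists_program [true]
  have h1 := hU.1.2 [] h p (mem_dom hp) List.nil_prefix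
  have h2 := hU.1.2 [] h q (mem_dom hq) List.nil_prefix
  subst h1 h2
  simpa using Part.mem_unique hp hq

theorem IsOptimal.one_le_length (hU : IsOptimal U) {p : List Bool} (hp : p ∈ U.Dom) :
    1 ≤ p.length :=
  List.length_pos_iff.2 fun h => hU.nil_notMem_dom (h ▸ hp)

theorem IsOptimal.exists_mem_dom (hU : IsOptimal U) : ∃ p, p ∈ U.Dom :=
  let ⟨p, hp⟩ := hU.exists_program []
  ⟨p, mem_dom hp⟩

theorem IsOptimal.exists_mem_dom_notMem (hU : IsOptimal U) (F : Finset (List Bool)) :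
    ∃ p ∈ U.Dom, p ∉ F := by
  choose g hg using hU.exists_program
  have hinj : Function.Injective g := fun s t h =>
    Part.mem_unique (hg s) (h ▸ hg t)
  obtain ⟨p, ⟨s, rfl⟩, hs⟩ := (Set.infinite_range_of_injective hinj).exists_notMem_finset F
  exact ⟨_, mem_dom (hg s), hs⟩

/-- Kraft's inequality for the domain of an optimal computer. -/
theorem IsOptimal.sum_two_pow_le_one (hU : IsOptimal U) {F : Finset (List Bool)}
    (hF : ∀ p ∈ F, p ∈ U.Dom) : ∑ p ∈ F, (1 / 2 : ℝ) ^ p.length ≤ 1 := by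
  -- A prefix-free set of nonempty words is uniquely decodable, the hypothesis of the Kraft–McMillan
  -- inequality.
  have key : ∀ L₁ L₂ : List (List Bool), (∀ w ∈ L₁, w ∈ U.Dom) → (∀ w ∈ L₂, w ∈ U.Dom) →
      L₁.flatten = L₂.flatten → L₁ = L₂ := by
    intro L₁
    induction L₁ with
    | nil =>
      rintro (_ | ⟨q, L₂⟩) - h2 h
      · rfl
      · have := hU.one_le_length (h2 q (by simp))
        simp only [List.flatten_nil, List.flatten_cons, List.nil_eq, List.append_eq_nil_iff] at h
        simp [h.1] at this
    | cons p L₁ ih =>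
      rintro (_ | ⟨q, L₂⟩) h1 h2 h
      · have := hU.one_le_length (h1 p (by simp))
        simp only [List.flatten_nil, List.flatten_cons, List.append_eq_nil_iff] at h
        simp [h.1] at this
      · simp only [List.flatten_cons] at h
        have hpq : p = q := by
          have hp : p <+: q ++ L₂.flatten := h ▸ List.prefix_append _ _
          rcases List.prefix_or_prefix_of_prefix hp (List.prefix_append q _) with h' | h'
          · exact hU.1.2 p (h1 p (by simp)) q (h2 q (by simp)) h'
          · exact (hU.1.2 q (h2 q (by simp)) p (h1 p (by simp)) h').symm
        subst hpq
        rw [ih L₂ (fun w hw => h1 w (by simp [hw])) (fun w hw => h2 w (by simp [hw]))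
          (List.append_cancel_left h)]
  have := InformationTheory.kraft_mcmillan_inequality (S := F)
    (fun L₁ L₂ h1 h2 => key L₁ L₂ (fun w hw => hF w (h1 w hw)) fun w hw => hF w (h2 w hw))
  simpa using this

end Complexity

/-! ### Rational cuts of computable reals, of weights and of finite sums. -/

section RealCuts

variable {α β : Type*} [Primcodable α] [Primcodable β]

theorem ComputableReal.sigmaOne_lt {x : ℝ} (hx : ComputableReal x) :
    SigmaOne fun y : ℕ × ℕ => (y.1 : ℝ) / (y.2 + 1) < x := by
  obtain ⟨f, ⟨a, b, c, ha, hb, hc, hf⟩, hfx⟩ := hx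
  have h : SigmaOne fun y : ℕ × ℕ => ∃ z : ℕ × ℕ × ℕ × ℕ,
      (z.2.1 = a (z.1 + 1) ∧ z.2.2.1 = b (z.1 + 1) ∧ z.2.2.2 = c (z.1 + 1)) ∧
      (y.1 * (z.1 + 1) + (y.2 + 1)) * (z.2.2.2 + 1) + z.2.2.1 * ((y.2 + 1) * (z.1 + 1)) ≤
        z.2.1 * ((y.2 + 1) * (z.1 + 1)) := by
    refine SigmaOne.ex (.and (.and ?_ (.and ?_ ?_)) (SigmaOne.le (by fun_prop) (by fun_prop)))
    · exact (SigmaOne.of_computable ha).comp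
        (f := fun x : (ℕ × ℕ) × ℕ × ℕ × ℕ × ℕ => (x.2.1 + 1, x.2.2.1)) (by fun_prop)
    · exact (SigmaOne.of_computable hb).comp
        (f := fun x : (ℕ × ℕ) × ℕ × ℕ × ℕ × ℕ => (x.2.1 + 1, x.2.2.2.1)) (by fun_prop)
    · exact (SigmaOne.of_computable hc).comp
        (f := fun x : (ℕ × ℕ) × ℕ × ℕ × ℕ × ℕ => (x.2.1 + 1, x.2.2.2.2)) (by fun_prop)
  refine h.of_iff fun ⟨i, j⟩ => ?_
  -- The cut is certified by an approximation f (n + 1) whose error bound 1 / (n + 1) still leaves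
  -- it above i / (j + 1). The shift avoids the unconstrained index 0; clearing denominators leaves
  -- an inequality of naturals.
  have key : ∀ n : ℕ, (i * (n + 1) + (j + 1)) * (c (n + 1) + 1) +
      b (n + 1) * ((j + 1) * (n + 1)) ≤ a (n + 1) * ((j + 1) * (n + 1)) ↔
      (i : ℝ) / (j + 1) + 1 / (n + 1) ≤ (f (n + 1) : ℝ) := fun n => by
    rw [hf]
    push_cast
    rw [div_add_div _ _ (by positivity) (by positivity),
      div_le_div_iff₀ (by positivity) (by positivity), ← @Nat.cast_le ℝ]
    push_cast
    constructor <;> intro h <;> nlinarith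
  constructor
  · intro h
    simp only at h
    have hn' : ∃ n : ℕ, 1 / ((n : ℝ) + 1) < (x - (i : ℝ) / (j + 1)) / 2 :=
      exists_nat_one_div_lt (by linarith)
    obtain ⟨n, hn⟩ := hn'
    refine ⟨(n, _, _, _), ⟨rfl, rfl, rfl⟩, (key n).2 ?_⟩
    have := (abs_lt.1 (hfx (n + 1) (by omega))).2
    push_cast at this
    linarith
  · rintro ⟨⟨n, A, B, C⟩, ⟨hA, hB, hC⟩, h⟩
    simp only at hA hB hC h
    subst hA hB hC
    have h1 := (key n).1 h
    have := (abs_lt.1 (hfx (n + 1) (by omega))).1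
    push_cast at this
    simp only
    linarith

theorem ComputableReal.sigmaOne_gt {x : ℝ} (hx : ComputableReal x) :
    SigmaOne fun y : ℕ × ℕ => x < (y.1 : ℝ) / (y.2 + 1) := by
  obtain ⟨f, ⟨a, b, c, ha, hb, hc, hf⟩, hfx⟩ := hx
  have h : SigmaOne fun y : ℕ × ℕ => ∃ z : ℕ × ℕ × ℕ × ℕ,
      (z.2.1 = a (z.1 + 1) ∧ z.2.2.1 = b (z.1 + 1) ∧ z.2.2.2 = c (z.1 + 1)) ∧
      z.2.1 * ((y.2 + 1) * (z.1 + 1)) + (z.2.2.2 + 1) * (y.2 + 1) ≤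
        y.1 * ((z.1 + 1) * (z.2.2.2 + 1)) + z.2.2.1 * ((y.2 + 1) * (z.1 + 1)) := by
    refine SigmaOne.ex (.and (.and ?_ (.and ?_ ?_)) (SigmaOne.le (by fun_prop) (by fun_prop)))
    · exact (SigmaOne.of_computable ha).comp
        (f := fun x : (ℕ × ℕ) × ℕ × ℕ × ℕ × ℕ => (x.2.1 + 1, x.2.2.1)) (by fun_prop)
    · exact (SigmaOne.of_computable hb).comp
        (f := fun x : (ℕ × ℕ) × ℕ × ℕ × ℕ × ℕ => (x.2.1 + 1, x.2.2.2.1)) (by fun_prop)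
    · exact (SigmaOne.of_computable hc).comp
        (f := fun x : (ℕ × ℕ) × ℕ × ℕ × ℕ × ℕ => (x.2.1 + 1, x.2.2.2.2)) (by fun_prop)
  refine h.of_iff fun ⟨i, j⟩ => ?_
  have key : ∀ n : ℕ, a (n + 1) * ((j + 1) * (n + 1)) + (c (n + 1) + 1) * (j + 1) ≤
        i * ((n + 1) * (c (n + 1) + 1)) + b (n + 1) * ((j + 1) * (n + 1)) ↔
      (f (n + 1) : ℝ) + 1 / (n + 1) ≤ (i : ℝ) / (j + 1) := fun n => by
    rw [hf]
    push_cast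
    rw [div_add_div _ _ (by positivity) (by positivity),
      div_le_div_iff₀ (by positivity) (by positivity), ← @Nat.cast_le ℝ]
    push_cast
    constructor <;> intro h <;> nlinarith
  constructor
  · intro h
    simp only at h
    have hn' : ∃ n : ℕ, 1 / ((n : ℝ) + 1) < ((i : ℝ) / (j + 1) - x) / 2 :=
      exists_nat_one_div_lt (by linarith)
    obtain ⟨n, hn⟩ := hn'
    refine ⟨(n, _, _, _), ⟨rfl, rfl, rfl⟩, (key n).2 ?_⟩
    have := (abs_lt.1 (hfx (n + 1) (by omega))).1
    push_cast at this
    linarith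
  · rintro ⟨⟨n, A, B, C⟩, ⟨hA, hB, hC⟩, h⟩
    simp only at hA hB hC h
    subst hA hB hC
    have h1 := (key n).1 h
    have := (abs_lt.1 (hfx (n + 1) (by omega))).2
    push_cast at this
    simp only
    linarith

theorem sum_map_le_add {β : Type*} {x y : β → ℝ} {c : ℝ} (L : List β) (h : ∀ b ∈ L, x b ≤ y b + c) :
    (L.map x).sum ≤ (L.map y).sum + L.length * c := by
  induction L with
  | nil => simp
  | cons b L ih =>
    have h1 := h b (by simp)
    have h2 := ih fun b hb => h b (by simp [hb])
    simp only [List.map_cons, List.sum_cons, List.length_cons]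
    push_cast
    linarith

theorem sum_map_snd_div {β : Type*} (M : List (β × ℕ)) (N : ℝ) :
    (((M.map Prod.snd).sum : ℕ) : ℝ) / N = (M.map fun e => (e.2 : ℝ) / N).sum := by
  induction M with
  | nil => simp
  | cons e M ih => simp only [List.map_cons, List.sum_cons, ← ih]; push_cast; ring

/-- If the summands are uniformly lower semicomputable and `w` is upper semicomputable, then it is
recursively enumerable that a finite sum exceeds `w`. -/
theorem SigmaOne.lt_sum {x : α → β → ℝ} {w : α → ℝ} {P : α → β → Prop}
    (hP : ∀ a b, P a b → 0 < x a b)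
    (hx : SigmaOne fun y : (α × β) × (ℕ × ℕ) =>
      P y.1.1 y.1.2 ∧ (y.2.1 : ℝ) / (y.2.2 + 1) < x y.1.1 y.1.2)
    (hw : SigmaOne fun y : α × (ℕ × ℕ) => w y.1 < (y.2.1 : ℝ) / (y.2.2 + 1)) :
    SigmaOne fun y : α × List β => (∀ b ∈ y.2, P y.1 b) ∧ w y.1 < (y.2.map (x y.1)).sum := by
  have h : SigmaOne fun y : α × List β => ∃ z : ℕ × List (β × ℕ), z.2.map Prod.fst = y.2 ∧
      (∀ e ∈ z.2, P y.1 e.1 ∧ (e.2 : ℝ) / (z.1 + 1) < x y.1 e.1) ∧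
      w y.1 < (((z.2.map Prod.snd).sum : ℕ) : ℝ) / (z.1 + 1) := by
    refine SigmaOne.ex (.and (SigmaOne.eq (by fun_prop) (by fun_prop)) (.and ?_ ?_))
    · refine SigmaOne.forall_mem (p := fun (y : (α × List β) × ℕ × List (β × ℕ)) (e : β × ℕ) =>
        P y.1.1 e.1 ∧ (e.2 : ℝ) / (y.2.1 + 1) < x y.1.1 e.1) ?_ (by fun_prop)
      exact hx.comp (f := fun z : ((α × List β) × ℕ × List (β × ℕ)) × β × ℕ =>
        ((z.1.1.1, z.2.1), (z.2.2, z.1.2.1))) (by fun_prop)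
    · exact hw.comp (f := fun z : (α × List β) × ℕ × List (β × ℕ) =>
        (z.1.1, ((z.2.2.map Prod.snd).sum, z.2.1))) (by fun_prop)
  refine h.of_iff fun ⟨a, L⟩ => ?_
  simp only [sum_map_snd_div]
  constructor
  · rintro ⟨hL, hlt⟩
    obtain ⟨N, hN⟩ := exists_nat_gt ((L.length : ℝ) / ((L.map (x a)).sum - w a))
    rw [div_lt_iff₀ (sub_pos.2 hlt)] at hN
    -- The largest numerator over N + 1 strictly below the summand; it is a genuine natural because
    -- the summand is positive. The total loss is at most length / (N + 1), which N makes smaller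
    -- than the gap.
    refine ⟨(N, L.map fun b => (b, ⌈(N + 1) * x a b⌉₊ - 1)), by simp [Function.comp_def], ?_, ?_⟩
    · intro e he
      obtain ⟨b, hb, rfl⟩ := List.mem_map.1 he
      have hpos := hP a b (hL b hb)
      refine ⟨hL b hb, ?_⟩
      have h1 : 0 < ⌈((N : ℝ) + 1) * x a b⌉₊ := Nat.ceil_pos.2 (by positivity)
      have h2 : ((⌈((N : ℝ) + 1) * x a b⌉₊ - 1 : ℕ) : ℝ) < (N + 1) * x a b := by
        rw [← Nat.lt_ceil]
        omega
      rwa [div_lt_iff₀' (by positivity)]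
    · have h1 := sum_map_le_add (x := x a)
        (y := fun b => ((⌈((N : ℝ) + 1) * x a b⌉₊ - 1 : ℕ) : ℝ) / (N + 1)) (c := 1 / (N + 1)) L
        fun b hb => by
          have hpos := hP a b (hL b hb)
          have h1 : 0 < ⌈((N : ℝ) + 1) * x a b⌉₊ := Nat.ceil_pos.2 (by positivity)
          rw [← add_div, le_div_iff₀ (by positivity), mul_comm, Nat.cast_sub h1]
          simpa using Nat.le_ceil (((N : ℝ) + 1) * x a b)
      have h2 : (L.length : ℝ) * (1 / (N + 1)) < (L.map (x a)).sum - w a := by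
        rw [mul_one_div, div_lt_iff₀ (by positivity)]
        nlinarith
      simp only [List.map_map, Function.comp_def]
      linarith
  · rintro ⟨⟨N, M⟩, rfl, hM, hlt⟩
    refine ⟨fun b hb => ?_, hlt.trans_le ?_⟩
    · obtain ⟨e, he, rfl⟩ := List.mem_map.1 hb
      exact (hM e he).1
    · simp only [List.map_map, Function.comp_def]
      exact List.sum_le_sum fun e he => (hM e he).2.le

/-- If the summands are uniformly upper semicomputable and `w` is lower semicomputable, then it is
recursively enumerable that a finite sum is less than `w`. -/
theorem SigmaOne.sum_lt {x : α → β → ℝ} {w : α → ℝ} {P : α → β → Prop}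
    (hP : ∀ a b, P a b → 0 < x a b)
    (hx : SigmaOne fun y : (α × β) × (ℕ × ℕ) =>
      P y.1.1 y.1.2 ∧ x y.1.1 y.1.2 < (y.2.1 : ℝ) / (y.2.2 + 1))
    (hw : SigmaOne fun y : α × (ℕ × ℕ) => (y.2.1 : ℝ) / (y.2.2 + 1) < w y.1) :
    SigmaOne fun y : α × List β => (∀ b ∈ y.2, P y.1 b) ∧ (y.2.map (x y.1)).sum < w y.1 := by
  have h : SigmaOne fun y : α × List β => ∃ z : ℕ × List (β × ℕ), z.2.map Prod.fst = y.2 ∧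
      (∀ e ∈ z.2, P y.1 e.1 ∧ x y.1 e.1 < (e.2 : ℝ) / (z.1 + 1)) ∧
      (((z.2.map Prod.snd).sum : ℕ) : ℝ) / (z.1 + 1) < w y.1 := by
    refine SigmaOne.ex (.and (SigmaOne.eq (by fun_prop) (by fun_prop)) (.and ?_ ?_))
    · refine SigmaOne.forall_mem (p := fun (y : (α × List β) × ℕ × List (β × ℕ)) (e : β × ℕ) =>
        P y.1.1 e.1 ∧ x y.1.1 e.1 < (e.2 : ℝ) / (y.2.1 + 1)) ?_ (by fun_prop)
      exact hx.comp (f := fun z : ((α × List β) × ℕ × List (β × ℕ)) × β × ℕ =>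
        ((z.1.1.1, z.2.1), (z.2.2, z.1.2.1))) (by fun_prop)
    · exact hw.comp (f := fun z : (α × List β) × ℕ × List (β × ℕ) =>
        (z.1.1, ((z.2.2.map Prod.snd).sum, z.2.1))) (by fun_prop)
  refine h.of_iff fun ⟨a, L⟩ => ?_
  simp only [sum_map_snd_div]
  constructor
  · rintro ⟨hL, hlt⟩
    obtain ⟨N, hN⟩ := exists_nat_gt ((L.length : ℝ) / (w a - (L.map (x a)).sum))
    rw [div_lt_iff₀ (sub_pos.2 hlt)] at hN
    refine ⟨(N, L.map fun b => (b, ⌊(N + 1) * x a b⌋₊ + 1)), by simp [Function.comp_def], ?_, ?_⟩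
    · intro e he
      obtain ⟨b, hb, rfl⟩ := List.mem_map.1 he
      refine ⟨hL b hb, ?_⟩
      rw [lt_div_iff₀ (by positivity), mul_comm]
      push_cast
      exact Nat.lt_floor_add_one _
    · have h1 := sum_map_le_add (y := x a)
        (x := fun b => ((⌊((N : ℝ) + 1) * x a b⌋₊ + 1 : ℕ) : ℝ) / (N + 1)) (c := 1 / (N + 1)) L
        fun b hb => by
          have hpos := hP a b (hL b hb)
          rw [div_le_iff₀ (by positivity)]
          have := Nat.floor_le (by positivity : 0 ≤ ((N : ℝ) + 1) * x a b)
          have h3 : (1 / ((N : ℝ) + 1)) * (N + 1) = 1 := by field_simp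
          push_cast
          nlinarith
      have h2 : (L.length : ℝ) * (1 / (N + 1)) < w a - (L.map (x a)).sum := by
        rw [mul_one_div, div_lt_iff₀ (by positivity)]
        nlinarith
      simp only [List.map_map, Function.comp_def]
      linarith
  · rintro ⟨⟨N, M⟩, rfl, hM, hlt⟩
    refine ⟨fun b hb => ?_, hlt.trans_le' ?_⟩
    · obtain ⟨e, he, rfl⟩ := List.mem_map.1 hb
      exact (hM e he).1
    · simp only [List.map_map, Function.comp_def]
      exact List.sum_le_sum fun e he => (hM e he).2.le

theorem exists_nat_div_btwn {a b : ℝ} (ha : 0 ≤ a) (hab : a < b) :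
    ∃ c d : ℕ, a < (c : ℝ) / (d + 1) ∧ (c : ℝ) / (d + 1) < b := by
  obtain ⟨q, h1, h2⟩ := exists_rat_btwn hab
  have hq : 0 ≤ q := by exact_mod_cast ha.trans h1.le
  have hden : ((q.den - 1 : ℕ) : ℝ) + 1 = q.den := by
    rw [Nat.cast_sub q.pos]; simp
  have hnum : ((q.num.toNat : ℕ) : ℝ) = q.num := by
    have : ((q.num.toNat : ℕ) : ℤ) = q.num := Int.toNat_of_nonneg (Rat.num_nonneg.2 hq)
    exact_mod_cast this
  refine ⟨q.num.toNat, q.den - 1, ?_, ?_⟩ <;> rw [hden, hnum, ← Rat.cast_def] <;> assumption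

/-- The contribution of a program of length `l` to `W U Q D`. -/
noncomputable def weight (Q D : ℝ) (l : ℕ) : ℝ := (l : ℝ) ^ Q * (2 : ℝ) ^ (-(l : ℝ) / D)

theorem weight_nonneg (Q D : ℝ) (l : ℕ) : 0 ≤ weight Q D l := by
  unfold weight; positivity

theorem weight_pos (Q D : ℝ) {l : ℕ} (hl : 1 ≤ l) : 0 < weight Q D l := by
  have : (0 : ℝ) < l := by exact_mod_cast hl
  unfold weight; positivity

/-- At rational parameters this power clears both fractional exponents, so comparing a weight with a
rational becomes an inequality between naturals. -/
theorem weight_pow {l u v : ℕ} (hu : 0 < u) (hv : 0 < v) (c d : ℕ) :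
    weight ((c : ℝ) / (d + 1)) ((u : ℝ) / v) l ^ ((d + 1) * u) =
      (l : ℝ) ^ (c * u) / 2 ^ (l * v * (d + 1)) := by
  have hu' : (u : ℝ) ≠ 0 := by positivity
  have hv' : (v : ℝ) ≠ 0 := by positivity
  have hd : (d : ℝ) + 1 ≠ 0 := by positivity
  have h1 : ((l : ℝ) ^ ((c : ℝ) / (d + 1))) ^ ((d + 1) * u) = (l : ℝ) ^ (c * u) := by
    rw [← Real.rpow_natCast, ← Real.rpow_mul (by positivity), ← Real.rpow_natCast]
    congr 1
    push_cast
    field_simp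
  have h2 : ((2 : ℝ) ^ (-(l : ℝ) / ((u : ℝ) / v))) ^ ((d + 1) * u) =
      (2 ^ (l * v * (d + 1)))⁻¹ := by
    rw [← Real.rpow_natCast, ← Real.rpow_mul (by positivity), ← Real.rpow_natCast,
      ← Real.rpow_neg (by positivity)]
    congr 1
    push_cast
    field_simp
  rw [weight, mul_pow, h1, h2, div_eq_mul_inv]

theorem div_lt_weight_iff {l u v : ℕ} (hu : 0 < u) (hv : 0 < v) (c d i j : ℕ) :
    (i : ℝ) / (j + 1) < weight ((c : ℝ) / (d + 1)) ((u : ℝ) / v) l ↔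
      i ^ ((d + 1) * u) * 2 ^ (l * v * (d + 1)) < l ^ (c * u) * (j + 1) ^ ((d + 1) * u) := by
  rw [← pow_lt_pow_iff_left₀ (by positivity) (weight_nonneg _ _ _)
    (n := (d + 1) * u) (by positivity), weight_pow hu hv, div_pow,
    div_lt_div_iff₀ (by positivity) (by positivity), ← @Nat.cast_lt ℝ]
  push_cast
  rfl

theorem weight_lt_div_iff {l u v : ℕ} (hu : 0 < u) (hv : 0 < v) (c d i j : ℕ) :
    weight ((c : ℝ) / (d + 1)) ((u : ℝ) / v) l < (i : ℝ) / (j + 1) ↔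
      l ^ (c * u) * (j + 1) ^ ((d + 1) * u) < i ^ ((d + 1) * u) * 2 ^ (l * v * (d + 1)) := by
  rw [← pow_lt_pow_iff_left₀ (weight_nonneg _ _ _) (by positivity)
    (n := (d + 1) * u) (by positivity), weight_pow hu hv, div_pow,
    div_lt_div_iff₀ (by positivity) (by positivity), ← @Nat.cast_lt ℝ]
  push_cast
  rfl

theorem weight_mono_left {Q Q' : ℝ} (D : ℝ) {l : ℕ} (hl : 1 ≤ l) (h : Q ≤ Q') :
    weight Q D l ≤ weight Q' D l := by
  unfold weight
  have : (1 : ℝ) ≤ l := by exact_mod_cast hl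
  gcongr

theorem continuous_weight_left (D : ℝ) {l : ℕ} (hl : 1 ≤ l) :
    Continuous fun Q => weight Q D l := by
  have : (l : ℝ) ≠ 0 := by positivity
  unfold weight
  exact (Real.continuous_const_rpow this).mul continuous_const

variable {Q : ℝ}

theorem sigmaOne_lt_weight (hQ : ComputableReal Q) (hQ0 : 0 < Q) :
    SigmaOne fun y : ((ℕ × ℕ) × List Bool) × (ℕ × ℕ) =>
      (0 < y.1.1.1 ∧ 0 < y.1.1.2 ∧ 1 ≤ y.1.2.length) ∧
        (y.2.1 : ℝ) / (y.2.2 + 1) < weight Q ((y.1.1.1 : ℝ) / y.1.1.2) y.1.2.length := by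
  have h : SigmaOne fun y : ((ℕ × ℕ) × List Bool) × (ℕ × ℕ) =>
      (0 < y.1.1.1 ∧ 0 < y.1.1.2 ∧ 1 ≤ y.1.2.length) ∧
      ∃ z : ℕ × ℕ, (z.1 : ℝ) / (z.2 + 1) < Q ∧
        y.2.1 ^ ((z.2 + 1) * y.1.1.1) * 2 ^ (y.1.2.length * y.1.1.2 * (z.2 + 1)) <
          y.1.2.length ^ (z.1 * y.1.1.1) * (y.2.2 + 1) ^ ((z.2 + 1) * y.1.1.1) := by
    refine .and (.and (.lt ?_ ?_) (.and (.lt ?_ ?_) (.le ?_ ?_)))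
      (.ex (.and ?rel (.lt ?_ ?_)))
    case rel =>
      exact hQ.sigmaOne_lt.comp
        (f := fun y : (((ℕ × ℕ) × List Bool) × (ℕ × ℕ)) × ℕ × ℕ => y.2) (by fun_prop)
    all_goals fun_prop
  refine h.of_iff fun ⟨⟨⟨u, v⟩, b⟩, i, j⟩ => and_congr_right ?_
  rintro ⟨hu, hv, hl⟩
  simp only at hu hv hl ⊢
  constructor
  · intro hlt
    have h1 : ∀ᶠ q in nhds Q, (i : ℝ) / (j + 1) < weight q ((u : ℝ) / v) b.length :=
      (continuous_weight_left _ hl).continuousAt.eventually_const_lt hlt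
    -- Continuity in Q allows a rational exponent slightly below Q; conversely monotonicity in Q,
    -- valid as the length is at least 1, makes such an exponent a certificate.
    obtain ⟨a, haQ, ha⟩ := exists_Ioc_subset_of_mem_nhds h1 ⟨0, hQ0⟩
    obtain ⟨c, d, hc, hd⟩ := exists_nat_div_btwn (le_max_right a 0) (max_lt haQ hQ0)
    exact ⟨(c, d), hd, (div_lt_weight_iff hu hv c d i j).1
      (ha ⟨(le_max_left _ _).trans_lt hc, hd.le⟩)⟩
  · rintro ⟨⟨c, d⟩, hd, hlt⟩
    exact ((div_lt_weight_iff hu hv c d i j).2 hlt).trans_le (weight_mono_left _ hl hd.le)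

theorem sigmaOne_weight_lt (hQ : ComputableReal Q) (hQ0 : 0 < Q) :
    SigmaOne fun y : ((ℕ × ℕ) × List Bool) × (ℕ × ℕ) =>
      (0 < y.1.1.1 ∧ 0 < y.1.1.2 ∧ 1 ≤ y.1.2.length) ∧
        weight Q ((y.1.1.1 : ℝ) / y.1.1.2) y.1.2.length < (y.2.1 : ℝ) / (y.2.2 + 1) := by
  have h : SigmaOne fun y : ((ℕ × ℕ) × List Bool) × (ℕ × ℕ) =>
      (0 < y.1.1.1 ∧ 0 < y.1.1.2 ∧ 1 ≤ y.1.2.length) ∧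
      ∃ z : ℕ × ℕ, Q < (z.1 : ℝ) / (z.2 + 1) ∧
        y.1.2.length ^ (z.1 * y.1.1.1) * (y.2.2 + 1) ^ ((z.2 + 1) * y.1.1.1) <
          y.2.1 ^ ((z.2 + 1) * y.1.1.1) * 2 ^ (y.1.2.length * y.1.1.2 * (z.2 + 1)) := by
    refine .and (.and (.lt ?_ ?_) (.and (.lt ?_ ?_) (.le ?_ ?_)))
      (.ex (.and ?rel (.lt ?_ ?_)))
    case rel =>
      exact hQ.sigmaOne_gt.comp
        (f := fun y : (((ℕ × ℕ) × List Bool) × (ℕ × ℕ)) × ℕ × ℕ => y.2) (by fun_prop)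
    all_goals fun_prop
  refine h.of_iff fun ⟨⟨⟨u, v⟩, b⟩, i, j⟩ => and_congr_right ?_
  rintro ⟨hu, hv, hl⟩
  simp only at hu hv hl ⊢
  constructor
  · intro hlt
    have h1 : ∀ᶠ q in nhds Q, weight q ((u : ℝ) / v) b.length < (i : ℝ) / (j + 1) :=
      (continuous_weight_left _ hl).continuousAt.eventually_lt_const hlt
    obtain ⟨a, haQ, ha⟩ := exists_Ico_subset_of_mem_nhds h1 ⟨Q + 1, by linarith⟩
    obtain ⟨c, d, hc, hd⟩ := exists_nat_div_btwn hQ0.le haQ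
    exact ⟨(c, d), hc, (weight_lt_div_iff hu hv c d i j).1 (ha ⟨hc.le, hd⟩)⟩
  · rintro ⟨⟨c, d⟩, hd, hlt⟩
    exact (weight_mono_left _ hl hd.le).trans_lt ((weight_lt_div_iff hu hv c d i j).2 hlt)

theorem sigmaOne_lt_sum_weight (hQ : ComputableReal Q) (hQ0 : 0 < Q) {w : ℝ}
    (hw : ComputableReal w) :
    SigmaOne fun y : (ℕ × ℕ) × List (List Bool) =>
      (∀ p ∈ y.2, 0 < y.1.1 ∧ 0 < y.1.2 ∧ 1 ≤ p.length) ∧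
        w < (y.2.map fun p => weight Q ((y.1.1 : ℝ) / y.1.2) p.length).sum := by
  have h : SigmaOne fun y : (ℕ × ℕ) × ℕ × ℕ => w < (y.2.1 : ℝ) / (y.2.2 + 1) :=
    hw.sigmaOne_gt.comp (f := fun y : (ℕ × ℕ) × ℕ × ℕ => y.2) Primrec.snd
  have hx := sigmaOne_lt_weight hQ hQ0
  have h' := SigmaOne.lt_sum (α := ℕ × ℕ)
    (P := fun (a : ℕ × ℕ) (p : List Bool) => 0 < a.1 ∧ 0 < a.2 ∧ 1 ≤ p.length)
    (x := fun a p => weight Q ((a.1 : ℝ) / a.2) p.length) (w := fun _ => w)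
    (fun _ _ h => weight_pos _ _ h.2.2) hx h
  exact h'

theorem sigmaOne_sum_weight_lt (hQ : ComputableReal Q) (hQ0 : 0 < Q) {w : ℝ}
    (hw : ComputableReal w) :
    SigmaOne fun y : (ℕ × ℕ) × List (List Bool) =>
      (∀ p ∈ y.2, 0 < y.1.1 ∧ 0 < y.1.2 ∧ 1 ≤ p.length) ∧
        (y.2.map fun p => weight Q ((y.1.1 : ℝ) / y.1.2) p.length).sum < w := by
  have h : SigmaOne fun y : (ℕ × ℕ) × ℕ × ℕ => (y.2.1 : ℝ) / (y.2.2 + 1) < w :=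
    hw.sigmaOne_lt.comp (f := fun y : (ℕ × ℕ) × ℕ × ℕ => y.2) Primrec.snd
  have hx := sigmaOne_weight_lt hQ hQ0
  have h' := SigmaOne.sum_lt (α := ℕ × ℕ)
    (P := fun (a : ℕ × ℕ) (p : List Bool) => 0 < a.1 ∧ 0 < a.2 ∧ 1 ≤ p.length)
    (x := fun a p => weight Q ((a.1 : ℝ) / a.2) p.length) (w := fun _ => w)
    (fun _ _ h => weight_pos _ _ h.2.2) hx h
  exact h'

/-- It is recursively enumerable that a finite sum of `2 ^ (-|p|)` exceeds a dyadic rational. -/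
theorem sigmaOne_lt_sum_two_pow :
    SigmaOne fun y : (ℕ × ℕ) × List (List Bool) =>
      (y.1.1 : ℝ) / 2 ^ y.1.2 < (y.2.map fun p => (1 / 2 : ℝ) ^ p.length).sum := by
  have := SigmaOne.lt_sum (P := fun (_ : ℕ × ℕ) (_ : List Bool) => True)
    (x := fun _ p => (1 / 2 : ℝ) ^ p.length) (w := fun a => (a.1 : ℝ) / 2 ^ a.2)
    (fun _ _ _ => by positivity)
    ((SigmaOne.lt (f := fun y : ((ℕ × ℕ) × List Bool) × (ℕ × ℕ) => y.2.1 * 2 ^ y.1.2.length)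
      (g := fun y => y.2.2 + 1) (by fun_prop) (by fun_prop)).of_iff fun y => by
        rw [div_lt_iff₀ (by positivity), one_div, inv_pow, inv_mul_eq_div,
          lt_div_iff₀ (by positivity), ← @Nat.cast_lt ℝ]
        simp)
    ((SigmaOne.lt (f := fun y : (ℕ × ℕ) × (ℕ × ℕ) => y.1.1 * (y.2.2 + 1))
      (g := fun y => y.2.1 * 2 ^ y.1.2) (by fun_prop) (by fun_prop)).of_iff fun y => by
        rw [div_lt_div_iff₀ (by positivity) (by positivity), ← @Nat.cast_lt ℝ]
        simp)
  exact this.of_iff fun y => by simp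

end RealCuts

/-! ### Analytic estimates for a single weight. -/

section Weight

/-- The polynomial factor is absorbed by the exponential gap between D and D'. -/
theorem weight_le_const_mul (Q : ℝ) {D D' : ℝ} (hD : 0 < D) (hDD' : D < D') :
    ∃ C : ℝ, 0 < C ∧ ∀ l : ℕ, weight Q D l ≤ C * (2 : ℝ) ^ (-(l : ℝ) / D') := by
  have hb : 0 < Real.log 2 * (1 / D - 1 / D') := by
    have := one_div_lt_one_div_of_lt hD hDD'
    have := Real.log_pos one_lt_two
    exact mul_pos this (by linarith)
  have ht := (tendsto_rpow_mul_exp_neg_mul_atTop_nhds_zero Q _ hb).comp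
    tendsto_natCast_atTop_atTop
  obtain ⟨C, hC⟩ := ht.bddAbove_range
  refine ⟨max C 1, by positivity, fun l => ?_⟩
  have h1 : (l : ℝ) ^ Q * Real.exp (-(Real.log 2 * (1 / D - 1 / D')) * l) ≤ C := hC ⟨l, rfl⟩
  have h2 : weight Q D l = (l : ℝ) ^ Q * Real.exp (-(Real.log 2 * (1 / D - 1 / D')) * l) *
      (2 : ℝ) ^ (-(l : ℝ) / D') := by
    rw [weight, Real.rpow_def_of_pos two_pos, Real.rpow_def_of_pos two_pos, mul_assoc,
      ← Real.exp_add]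
    congr 2
    ring
  rw [h2]
  exact mul_le_mul_of_nonneg_right (h1.trans (le_max_left _ _)) (by positivity)

theorem weight_mono (Q : ℝ) {D D' : ℝ} (hD : 0 < D) (h : D ≤ D') (l : ℕ) :
    weight Q D l ≤ weight Q D' l := by
  unfold weight
  have : -(l : ℝ) / D ≤ -(l : ℝ) / D' := by
    rw [neg_div, neg_div, neg_le_neg_iff]
    gcongr
  gcongr
  norm_num

theorem weight_eq_mul_rpow (Q : ℝ) (D D' : ℝ) (l : ℕ) :
    weight Q D l = weight Q D' l * (2 : ℝ) ^ (-((l : ℝ) * (1 / D - 1 / D'))) := by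
  rw [weight, weight, mul_assoc, ← Real.rpow_add two_pos]
  congr 2
  ring

/-- Differentiating 2^(-l/D) in D brings down a factor of order l / D², hence the exponent Q + 1;
taking that weight at t₀ makes the Lipschitz bound uniform in t. The factor log 2 < 1 is dropped. -/
theorem weight_sub_le (Q : ℝ) {T t t₀ : ℝ} (hT : 0 < T) (hTt : T ≤ t) (ht : t ≤ t₀) {l : ℕ}
    (hl : 1 ≤ l) :
    weight Q t l ≤ weight Q T l + (t - T) / T ^ 2 * weight (Q + 1) t₀ l := by
  have htpos : 0 < t := hT.trans_le hTt
  have hl0 : (0 : ℝ) < l := by exact_mod_cast hl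
  have hd : 1 / T - 1 / t = (t - T) / (T * t) := by field_simp
  set y := (l : ℝ) * (1 / T - 1 / t) with hy
  have hy0 : 0 ≤ y := by
    rw [hy, hd]
    have : 0 ≤ t - T := by linarith
    positivity
  have hyle : y ≤ l * ((t - T) / T ^ 2) := by
    rw [hy, hd]
    have : 0 ≤ t - T := by linarith
    gcongr
    nlinarith
  have h1 : 1 - y ≤ (2 : ℝ) ^ (-y) := by
    rw [Real.rpow_def_of_pos two_pos]
    have h2 := Real.add_one_le_exp (Real.log 2 * -y)
    have h3 : Real.log 2 < 1 := by linarith [Real.log_two_lt_d9]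
    nlinarith
  have h4 : weight Q t l * l = weight (Q + 1) t l := by
    rw [weight, weight, Real.rpow_add_one hl0.ne']
    ring
  have h5 := weight_mono (Q + 1) htpos ht l
  have h6 := weight_nonneg Q t l
  have h7 : weight Q t l * y ≤ (t - T) / T ^ 2 * weight (Q + 1) t₀ l := by
    calc weight Q t l * y ≤ weight Q t l * (l * ((t - T) / T ^ 2)) := by gcongr
      _ = (t - T) / T ^ 2 * weight (Q + 1) t l := by rw [← h4]; ring
      _ ≤ _ := by
        have : 0 ≤ t - T := by linarith
        gcongr
  rw [weight_eq_mul_rpow Q T t l]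
  nlinarith

/-- The exponent grows by l (t - T) / (T t) ≥ t - T, and exp x ≥ 1 + x. This linear growth is what
separates neighbouring dyadic points. -/
theorem le_weight_sub (Q : ℝ) {T t : ℝ} (hT : 0 < T) (hTt : T ≤ t) (ht : t ≤ 1) {l : ℕ}
    (hl : 1 ≤ l) :
    weight Q T l + weight Q T l * Real.log 2 * (t - T) ≤ weight Q t l := by
  have htpos : 0 < t := hT.trans_le hTt
  have hl0 : (1 : ℝ) ≤ l := by exact_mod_cast hl
  have hd : 1 / T - 1 / t = (t - T) / (T * t) := by field_simp
  have hsub : 0 ≤ t - T := by linarith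
  have hTt1 : T * t ≤ 1 := by nlinarith
  have h1 : t - T ≤ 1 / T - 1 / t := by
    rw [hd]
    exact le_div_self hsub (by positivity) hTt1
  have hlog := Real.log_pos one_lt_two
  have h2 : 1 + Real.log 2 * (t - T) ≤ (2 : ℝ) ^ (-((l : ℝ) * (1 / t - 1 / T))) := by
    rw [Real.rpow_def_of_pos two_pos]
    have h2 := Real.add_one_le_exp (Real.log 2 * -((l : ℝ) * (1 / t - 1 / T)))
    have h3 : t - T ≤ -((l : ℝ) * (1 / t - 1 / T)) := by nlinarith
    nlinarith
  rw [weight_eq_mul_rpow Q t T l]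
  have := weight_nonneg Q T l
  nlinarith

end Weight

/-! ### The partition sum W: convergence, monotonicity and tail bounds. -/

section PartitionSum

variable {U : List Bool →. List Bool} (hU : IsOptimal U)
include hU

theorem IsOptimal.exists_sum_weight_le (Q : ℝ) {D : ℝ} (hD : 0 < D) (hD1 : D < 1) :
    ∃ C : ℝ, 0 < C ∧ ∀ F : Finset (List Bool), (∀ p ∈ F, p ∈ U.Dom) →
      ∑ p ∈ F, weight Q D p.length ≤ C := by
  obtain ⟨C, hC, h⟩ := weight_le_const_mul Q hD hD1
  refine ⟨C, hC, fun F hF => ?_⟩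
  calc ∑ p ∈ F, weight Q D p.length ≤ ∑ p ∈ F, C * (1 / 2 : ℝ) ^ p.length := by
        refine Finset.sum_le_sum fun p _ => (h _).trans_eq ?_
        rw [div_one, Real.rpow_neg two_pos.le, Real.rpow_natCast, one_div, inv_pow]
    _ = C * ∑ p ∈ F, (1 / 2 : ℝ) ^ p.length := by rw [Finset.mul_sum]
    _ ≤ C := mul_le_of_le_one_right hC.le (hU.sum_two_pow_le_one hF)

theorem IsOptimal.summable_weight (Q : ℝ) {D : ℝ} (hD : 0 < D) (hD1 : D < 1) :
    Summable fun p : U.Dom => weight Q D (p : List Bool).length := by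
  obtain ⟨C, -, hC⟩ := hU.exists_sum_weight_le Q hD hD1
  refine summable_of_sum_le (fun _ => weight_nonneg _ _ _) (c := C) fun s => ?_
  have := hC (s.map (Function.Embedding.subtype _)) fun p hp => by
    obtain ⟨q, -, rfl⟩ := Finset.mem_map.1 hp
    exact q.2
  simpa using this

theorem IsOptimal.sum_weight_le_W (Q : ℝ) {D : ℝ} (hD : 0 < D) (hD1 : D < 1)
    {F : Finset (List Bool)} (hF : ∀ p ∈ F, p ∈ U.Dom) :
    ∑ p ∈ F, weight Q D p.length ≤ W U Q D := by
  classical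
  rw [← Finset.sum_subtype_of_mem (p := (· ∈ U.Dom)) (fun p => weight Q D p.length) hF]
  exact (hU.summable_weight Q hD hD1).sum_le_tsum _ fun _ _ => weight_nonneg _ _ _

theorem IsOptimal.exists_lt_sum_weight (Q : ℝ) {D a : ℝ} (hD : 0 < D) (hD1 : D < 1)
    (ha : a < W U Q D) :
    ∃ F : Finset (List Bool), (∀ p ∈ F, p ∈ U.Dom) ∧ a < ∑ p ∈ F, weight Q D p.length := by
  obtain ⟨s, hs⟩ := ((hU.summable_weight Q hD hD1).hasSum.eventually (lt_mem_nhds ha)).exists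
  refine ⟨s.map (Function.Embedding.subtype _), fun p hp => ?_, by simpa using hs⟩
  obtain ⟨q, -, rfl⟩ := Finset.mem_map.1 hp
  exact q.2

theorem IsOptimal.W_le (Q : ℝ) {D a : ℝ} (hD : 0 < D) (hD1 : D < 1)
    (h : ∀ F : Finset (List Bool), (∀ p ∈ F, p ∈ U.Dom) → ∑ p ∈ F, weight Q D p.length ≤ a) :
    W U Q D ≤ a := by
  by_contra! ha
  obtain ⟨F, hF, hlt⟩ := hU.exists_lt_sum_weight Q hD hD1 ha
  exact absurd (h F hF) (not_le.2 hlt)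

/-- Strict because the domain is infinite and every weight in it is positive. -/
theorem IsOptimal.sum_weight_lt_W (Q : ℝ) {D : ℝ} (hD : 0 < D) (hD1 : D < 1)
    {F : Finset (List Bool)} (hF : ∀ p ∈ F, p ∈ U.Dom) :
    ∑ p ∈ F, weight Q D p.length < W U Q D := by
  classical
  obtain ⟨q, hq, hqF⟩ := hU.exists_mem_dom_notMem F
  have := hU.sum_weight_le_W Q hD hD1 (F := insert q F) fun p hp => by
    rcases Finset.mem_insert.1 hp with rfl | hp
    exacts [hq, hF p hp]
  rw [Finset.sum_insert hqF] at this
  linarith [weight_pos Q D (hU.one_le_length hq)]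

theorem IsOptimal.W_strictMono (Q : ℝ) {D D' : ℝ} (hD : 0 < D) (h : D < D') (hD' : D' < 1) :
    W U Q D < W U Q D' := by
  obtain ⟨q, hq⟩ := hU.exists_mem_dom
  refine (hU.summable_weight Q hD (h.trans hD')).tsum_lt_tsum (i := ⟨q, hq⟩)
    (fun p => weight_mono Q hD h.le _) ?_ (hU.summable_weight Q (hD.trans h) hD')
  have h1 := le_weight_sub Q hD h.le hD'.le (hU.one_le_length hq)
  have h2 := weight_pos Q D (hU.one_le_length hq)
  have h3 := Real.log_pos one_lt_two
  have : 0 < weight Q D q.length * Real.log 2 * (D' - D) :=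
    mul_pos (mul_pos h2 h3) (sub_pos.2 h)
  change weight Q D q.length < weight Q D' q.length
  linarith

/-- Finite partial sums of `W` are Lipschitz in `D`, uniformly in the partial sum. -/
theorem IsOptimal.exists_sum_weight_sub_le (Q : ℝ) {T t₀ : ℝ} (hT : 0 < T) (ht₀ : T < t₀)
    (ht1 : t₀ < 1) :
    ∃ C : ℝ, 0 < C ∧ ∀ F : Finset (List Bool), (∀ p ∈ F, p ∈ U.Dom) → ∀ t, T ≤ t → t ≤ t₀ →
      ∑ p ∈ F, weight Q t p.length ≤ ∑ p ∈ F, weight Q T p.length + C * (t - T) := by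
  obtain ⟨C, hC, h⟩ := hU.exists_sum_weight_le (Q + 1) (hT.trans ht₀) ht1
  refine ⟨C / T ^ 2, by positivity, fun F hF t hTt htt => ?_⟩
  have hsub : 0 ≤ t - T := by linarith
  calc ∑ p ∈ F, weight Q t p.length
      ≤ ∑ p ∈ F, (weight Q T p.length + (t - T) / T ^ 2 * weight (Q + 1) t₀ p.length) :=
        Finset.sum_le_sum fun p hp => weight_sub_le Q hT hTt htt (hU.one_le_length (hF p hp))
    _ = ∑ p ∈ F, weight Q T p.length +
          (t - T) / T ^ 2 * ∑ p ∈ F, weight (Q + 1) t₀ p.length := by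
        rw [Finset.sum_add_distrib, Finset.mul_sum]
    _ ≤ ∑ p ∈ F, weight Q T p.length + (t - T) / T ^ 2 * C := by
        gcongr
        exact h F hF
    _ = _ := by ring

/-- If the programs outside `F` have total measure at most `2 ^ (-m)`, then they contribute at most
`O(2 ^ (-m / T'))` to `W U Q T`. -/
theorem IsOptimal.exists_W_le_sum_add (Q : ℝ) {T T' : ℝ} (hT : 0 < T) (hTT' : T < T')
    (hT' : T' < 1) :
    ∃ C : ℝ, 0 < C ∧ ∀ (F : Finset (List Bool)) (m : ℕ), (∀ p ∈ F, p ∈ U.Dom) →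
      (∀ G : Finset (List Bool), (∀ p ∈ G, p ∈ U.Dom) → Disjoint F G →
        ∑ p ∈ G, (1 / 2 : ℝ) ^ p.length ≤ (1 / 2) ^ m) →
      W U Q T ≤ ∑ p ∈ F, weight Q T p.length + C * (2 : ℝ) ^ (-(m : ℝ) / T') := by
  classical
  obtain ⟨C, hC, h⟩ := weight_le_const_mul Q hT hTT'
  refine ⟨C, hC, fun F m hF hm => hU.W_le Q hT (hTT'.trans hT') fun G hG => ?_⟩
  have hsplit : ∑ p ∈ G, weight Q T p.length ≤
      ∑ p ∈ F, weight Q T p.length + ∑ p ∈ G \ F, weight Q T p.length := by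
    rw [← Finset.sum_union Finset.disjoint_sdiff, Finset.union_sdiff_self_eq_union]
    exact Finset.sum_le_sum_of_subset_of_nonneg Finset.subset_union_right
      fun _ _ _ => weight_nonneg _ _ _
  have hdom : ∀ p ∈ G \ F, p ∈ U.Dom := fun p hp => hG p (Finset.mem_sdiff.1 hp).1
  have hhalf : ∀ l : ℕ, (1 / 2 : ℝ) ^ l = (2 : ℝ) ^ (-(l : ℝ)) := fun l => by
    rw [Real.rpow_neg two_pos.le, Real.rpow_natCast, one_div, inv_pow]
  -- The measure bound applied to a single program forces its length to be at least m.
  have hlen : ∀ p ∈ G \ F, m ≤ p.length := fun p hp => by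
    have := hm {p} (by simpa using hdom p hp) (by simpa using (Finset.mem_sdiff.1 hp).2)
    rw [Finset.sum_singleton] at this
    exact (pow_le_pow_iff_right_of_lt_one₀ (by norm_num) (by norm_num)).1 this
  have hT'0 : 0 < T' := hT.trans hTT'
  have hθ : 0 ≤ 1 / T' - 1 := by
    rw [sub_nonneg, le_div_iff₀ hT'0]
    linarith
  -- Split 2^(-l/T') as 2^(-l(1/T'-1)) · 2^(-l): the first factor is bounded using l ≥ m, the second
  -- is summed by the measure bound.
  have hterm : ∀ p ∈ G \ F, weight Q T p.length ≤
      C * (2 : ℝ) ^ (-((m : ℝ) * (1 / T' - 1))) * (1 / 2 : ℝ) ^ p.length := fun p hp => by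
    refine (h _).trans ?_
    rw [hhalf, mul_assoc, ← Real.rpow_add two_pos]
    have h1 : (m : ℝ) ≤ p.length := by exact_mod_cast hlen p hp
    have h2 : -(p.length : ℝ) / T' ≤ -((m : ℝ) * (1 / T' - 1)) + -(p.length : ℝ) := by
      have : -(p.length : ℝ) / T' = -((p.length : ℝ) * (1 / T' - 1)) + -(p.length : ℝ) := by ring
      rw [this]
      gcongr
    gcongr
    norm_num
  calc ∑ p ∈ G, weight Q T p.length
      ≤ ∑ p ∈ F, weight Q T p.length + ∑ p ∈ G \ F, weight Q T p.length := hsplit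
    _ ≤ ∑ p ∈ F, weight Q T p.length + ∑ p ∈ G \ F,
          C * (2 : ℝ) ^ (-((m : ℝ) * (1 / T' - 1))) * (1 / 2 : ℝ) ^ p.length := by
        gcongr with p hp
        exact hterm p hp
    _ ≤ ∑ p ∈ F, weight Q T p.length +
          C * (2 : ℝ) ^ (-((m : ℝ) * (1 / T' - 1))) * (1 / 2) ^ m := by
        rw [← Finset.mul_sum]
        gcongr
        exact hm _ hdom Finset.disjoint_sdiff
    _ = _ := by
        rw [hhalf, mul_assoc, ← Real.rpow_add two_pos]
        congr 3
        ring

/-- Dyadic approximation of the halting probability by a finite sum. -/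
theorem IsOptimal.exists_approx_halting (m : ℕ) :
    ∃ X : ℕ, X < 2 ^ m ∧ (∃ F : Finset (List Bool), (∀ p ∈ F, p ∈ U.Dom) ∧
        (X : ℝ) / 2 ^ m < ∑ p ∈ F, (1 / 2 : ℝ) ^ p.length) ∧
      ∀ F G : Finset (List Bool), (∀ p ∈ F, p ∈ U.Dom) → (∀ p ∈ G, p ∈ U.Dom) → Disjoint F G →
        (X : ℝ) / 2 ^ m < ∑ p ∈ F, (1 / 2 : ℝ) ^ p.length →
        ∑ p ∈ G, (1 / 2 : ℝ) ^ p.length ≤ (1 / 2) ^ m := by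
  classical
  let P : ℕ → Prop := fun X => ∃ F : Finset (List Bool), (∀ p ∈ F, p ∈ U.Dom) ∧
    (X : ℝ) / 2 ^ m < ∑ p ∈ F, (1 / 2 : ℝ) ^ p.length
  have hP0 : P 0 := by
    obtain ⟨q, hq⟩ := hU.exists_mem_dom
    refine ⟨{q}, by simpa using hq, ?_⟩
    rw [Finset.sum_singleton, Nat.cast_zero, zero_div]
    positivity
  have hPlt : ∀ X, P X → X < 2 ^ m := by
    rintro X ⟨F, hF, hX⟩
    have := hX.trans_le (hU.sum_two_pow_le_one hF)
    rw [div_lt_one (by positivity)] at this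
    exact_mod_cast this
  have hX := Nat.findGreatest_spec (P := P) (Nat.zero_le (2 ^ m)) hP0
  refine ⟨_, hPlt _ hX, hX, fun F G hF hG hFG hlt => ?_⟩
  -- By maximality of X no finite sum exceeds (X + 1) / 2^m, so only 2^(-m) is left for programs
  -- outside F.
  have hnot : ¬ P (Nat.findGreatest P (2 ^ m) + 1) := fun h =>
    Nat.findGreatest_is_greatest (P := P) (Nat.lt_succ_self _) (hPlt _ h).le h
  simp only [P, not_exists, not_and, not_lt] at hnot
  have := hnot (F ∪ G) fun p hp => by
    rcases Finset.mem_union.1 hp with hp | hp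
    exacts [hF p hp, hG p hp]
  rw [Finset.sum_union hFG, Nat.cast_succ, add_div] at this
  rw [one_div_pow]
  linarith

end PartitionSum

/-! ### Enumerating halting programs and comparing their weight sums with w. -/

section Enumeration

theorem sigmaOne_nodup {β : Type*} [Primcodable β] : SigmaOne fun L : List β => L.Nodup := by
  have h : SigmaOne fun L : List β => ∀ j ∈ List.range L.length, ∀ i ∈ List.range j,
      L[i]? ≠ L[j]? := by
    refine SigmaOne.forall_mem (p := fun (L : List β) (j : ℕ) => ∀ i ∈ List.range j,
      L[i]? ≠ L[j]?) (SigmaOne.forall_mem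
        (p := fun (y : List β × ℕ) (i : ℕ) => y.1[i]? ≠ y.1[y.2]?) ?_
        (Primrec.list_range.comp Primrec.snd)) (Primrec.list_range.comp Primrec.list_length)
    exact SigmaOne.of_primrecPred (Primrec.eq.comp
      (Primrec.list_getElem?.comp (by fun_prop) (by fun_prop))
      (Primrec.list_getElem?.comp (by fun_prop) (by fun_prop))).not
  refine h.of_iff fun L => ?_
  rw [List.nodup_iff_getElem?_ne_getElem?]
  simp only [List.mem_range]
  exact ⟨fun H j hj i hi => H i j hi hj, fun H i j hi hj => H j hj i hi⟩

/-- `L` lists distinct programs on which `U` halts. -/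
def HaltList (U : List Bool →. List Bool) (L : List (List Bool)) : Prop :=
  L.Nodup ∧ ∀ p ∈ L, p ∈ U.Dom

theorem HaltList.sum_eq {U : List Bool →. List Bool} {L : List (List Bool)} (hL : HaltList U L)
    (f : List Bool → ℝ) : (L.map f).sum = ∑ p ∈ L.toFinset, f p :=
  (List.sum_toFinset f hL.1).symm

theorem haltList_toList {U : List Bool →. List Bool} {F : Finset (List Bool)}
    (hF : ∀ p ∈ F, p ∈ U.Dom) : HaltList U F.toList :=
  ⟨F.nodup_toList, by simpa using hF⟩

theorem sigmaOne_haltList {U : List Bool →. List Bool} (hU : Partrec U) :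
    SigmaOne (HaltList U) := by
  have hdom : SigmaOne fun p : List Bool => ∃ s, s ∈ U p :=
    SigmaOne.ex (p := fun p s => s ∈ U p) (SigmaOne.of_partrec hU)
  refine sigmaOne_nodup.and (SigmaOne.forall_mem (p := fun (_ : List (List Bool)) p => p ∈ U.Dom)
    ?_ Primrec.id)
  exact (hdom.comp Primrec.snd).of_iff fun y => PFun.mem_dom _ _

variable {U : List Bool →. List Bool} {Q : ℝ}

theorem IsOptimal.sigmaOne_lt_sum (hU : IsOptimal U) (hQ : ComputableReal Q) (hQ0 : 0 < Q)
    {w : ℝ} (hw : ComputableReal w) :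
    SigmaOne fun y : (ℕ × ℕ) × List (List Bool) => (0 < y.1.1 ∧ 0 < y.1.2) ∧ HaltList U y.2 ∧
        w < (y.2.map fun p => weight Q ((y.1.1 : ℝ) / y.1.2) p.length).sum := by
  have h1 : SigmaOne fun y : (ℕ × ℕ) × List (List Bool) => 0 < y.1.1 ∧ 0 < y.1.2 :=
    (SigmaOne.lt (by fun_prop) (by fun_prop)).and (SigmaOne.lt (by fun_prop) (by fun_prop))
  have h2 := (sigmaOne_haltList hU.1.1).comp (f := fun y : (ℕ × ℕ) × List (List Bool) => y.2)
    Primrec.snd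
  refine (h1.and (h2.and (sigmaOne_lt_sum_weight hQ hQ0 hw))).of_iff fun y => ?_
  refine and_congr_right fun h => and_congr_right fun hL => ?_
  exact ⟨fun H => ⟨fun p hp => ⟨h.1, h.2, hU.one_le_length (hL.2 p hp)⟩, H⟩, fun H => H.2⟩

theorem IsOptimal.sigmaOne_sum_lt (hU : IsOptimal U) (hQ : ComputableReal Q) (hQ0 : 0 < Q)
    {w : ℝ} (hw : ComputableReal w) :
    SigmaOne fun y : (ℕ × ℕ) × List (List Bool) => (0 < y.1.1 ∧ 0 < y.1.2) ∧ HaltList U y.2 ∧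
        (y.2.map fun p => weight Q ((y.1.1 : ℝ) / y.1.2) p.length).sum < w := by
  have h1 : SigmaOne fun y : (ℕ × ℕ) × List (List Bool) => 0 < y.1.1 ∧ 0 < y.1.2 :=
    (SigmaOne.lt (by fun_prop) (by fun_prop)).and (SigmaOne.lt (by fun_prop) (by fun_prop))
  have h2 := (sigmaOne_haltList hU.1.1).comp (f := fun y : (ℕ × ℕ) × List (List Bool) => y.2)
    Primrec.snd
  refine (h1.and (h2.and (sigmaOne_sum_weight_lt hQ hQ0 hw))).of_iff fun y => ?_
  refine and_congr_right fun h => and_congr_right fun hL => ?_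
  exact ⟨fun H => ⟨fun p hp => ⟨h.1, h.2, hU.one_le_length (hL.2 p hp)⟩, H⟩, fun H => H.2⟩

end Enumeration

/-! ### Right- and left-computability in terms of cuts. -/

section RightLeft

/-- A real in `(0, 1)` with recursively enumerable right cut is right-computable. -/
theorem rightComputable_of_sigmaOne {T : ℝ} (hT0 : 0 < T) (hT1 : T < 1)
    (h : SigmaOne fun y : ℕ × ℕ => (0 < y.1 ∧ y.1 < y.2) ∧ T < (y.1 : ℝ) / y.2) :
    RightComputable T := by
  classical
  obtain ⟨R, hR, hRT⟩ := h
  -- This enumerates the fractions in the right cut; the default (1, 1) stands for 1, itself above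
  -- T.
  let g : ℕ → ℕ × ℕ := fun k =>
    if R (Denumerable.ofNat (ℕ × ℕ) k.unpair.1) k.unpair.2 then
      Denumerable.ofNat (ℕ × ℕ) k.unpair.1 else (1, 1)
  have hof : Primrec fun k : ℕ => Denumerable.ofNat (ℕ × ℕ) k.unpair.1 :=
    (Primrec.ofNat _).comp (Primrec.fst.comp Primrec.unpair)
  have hg : Primrec g :=
    Primrec.ite (hR.comp hof (Primrec.snd.comp Primrec.unpair)) hof (Primrec.const _)
  have hgT : ∀ k, 0 < (g k).2 ∧ T < ((g k).1 : ℝ) / (g k).2 := fun k => by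
    simp only [g]
    split_ifs with hk
    · have := (hRT _).2 ⟨_, hk⟩
      exact ⟨by omega, this.2⟩
    · simpa using hT1
  have hgsurj : ∀ u v : ℕ, 0 < u → u < v → T < (u : ℝ) / v → ∃ k, g k = (u, v) :=
    fun u v hu huv hT => by
      obtain ⟨n, hn⟩ := (hRT (u, v)).1 ⟨⟨hu, huv⟩, hT⟩
      refine ⟨Nat.pair (Encodable.encode (u, v)) n, ?_⟩
      simp only [g, Nat.unpair_pair, Denumerable.ofNat_encode]
      rw [if_pos hn]
  -- Keeping the running minimum of the enumeration gives a decreasing sequence, which converges to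
  -- T.
  let step : ℕ → ℕ × ℕ → ℕ × ℕ := fun k y =>
    if (g k).1 * y.2 < y.1 * (g k).2 then g k else y
  let s : ℕ → ℕ × ℕ := fun n => Nat.rec (1, 1) step n
  have hs : Primrec s := by
    refine Primrec.nat_rec₁ _ (Primrec.ite (Primrec.nat_lt.comp ?_ ?_) ?_ ?_) <;> fun_prop
  have hsT : ∀ n, 0 < (s n).2 ∧ T < ((s n).1 : ℝ) / (s n).2 := fun n => by
    induction n with
    | zero => simpa [s] using hT1
    | succ n ih =>
      change 0 < (step n (s n)).2 ∧ T < ((step n (s n)).1 : ℝ) / (step n (s n)).2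
      simp only [step]
      split_ifs
      exacts [hgT n, ih]
  have hsstep : ∀ n, ((s (n + 1)).1 : ℝ) / (s (n + 1)).2 ≤ ((s n).1 : ℝ) / (s n).2 ∧
      ((s (n + 1)).1 : ℝ) / (s (n + 1)).2 ≤ ((g n).1 : ℝ) / (g n).2 := fun n => by
    change ((step n (s n)).1 : ℝ) / (step n (s n)).2 ≤ _ ∧
      ((step n (s n)).1 : ℝ) / (step n (s n)).2 ≤ _
    have h1 : (0 : ℝ) < (g n).2 := by exact_mod_cast (hgT n).1
    have h2 : (0 : ℝ) < (s n).2 := by exact_mod_cast (hsT n).1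
    simp only [step]
    split_ifs with hlt
    · refine ⟨?_, le_rfl⟩
      rw [div_le_div_iff₀ h1 h2]
      exact_mod_cast hlt.le
    · refine ⟨le_rfl, ?_⟩
      rw [div_le_div_iff₀ h2 h1]
      exact_mod_cast not_lt.1 hlt
  have hanti : Antitone fun n => ((s n).1 : ℝ) / (s n).2 :=
    antitone_nat_of_succ_le fun n => (hsstep n).1
  refine ⟨fun n => ((s n).1 : ℚ) / (s n).2, ⟨fun n => (s n).1, fun _ => 0, fun n => (s n).2 - 1,
    Primrec.to_comp (by fun_prop), Primrec.to_comp (by fun_prop), Primrec.to_comp (by fun_prop),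
    fun n => ?_⟩, fun n _ => ?_, ?_⟩
  · rw [Nat.cast_sub (hsT n).1]
    simp
  · push_cast
    exact (hsT n).2.le
  · push_cast
    refine tendsto_order.2 ⟨fun a ha => Eventually.of_forall fun n => ha.trans (hsT n).2,
      fun a ha => ?_⟩
    obtain ⟨c, d, hc, hd⟩ := exists_nat_div_btwn hT0.le (lt_min ha hT1)
    have hd1 : (c : ℝ) / (d + 1) < 1 := hd.trans_le (min_le_right _ _)
    rw [div_lt_one (by positivity)] at hd1
    have hc0 : 0 < c := by
      rcases Nat.eq_zero_or_pos c with rfl | h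
      · simp at hc; linarith
      · exact h
    obtain ⟨k, hk⟩ := hgsurj c (d + 1) hc0 (by exact_mod_cast hd1) (by push_cast; exact hc)
    filter_upwards [eventually_ge_atTop (k + 1)] with n hn
    have h1 := (hanti hn).trans (hsstep k).2
    rw [hk] at h1
    push_cast at h1
    exact h1.trans_lt (hd.trans_le (min_le_left _ _))

theorem LeftComputable.sigmaOne_lt {T : ℝ} (h : LeftComputable T) :
    SigmaOne fun y : ℕ × ℕ => 0 < y.2 ∧ (y.1 : ℝ) / y.2 < T := by
  obtain ⟨g, ⟨a, b, c, ha, hb, hc, hg⟩, hgT, hlim⟩ := h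
  have h : SigmaOne fun y : ℕ × ℕ => 0 < y.2 ∧ ∃ z : ℕ × ℕ × ℕ × ℕ,
      (z.2.1 = a (z.1 + 1) ∧ z.2.2.1 = b (z.1 + 1) ∧ z.2.2.2 = c (z.1 + 1)) ∧
      y.1 * (z.2.2.2 + 1) + y.2 * z.2.1 < y.2 * z.2.2.1 := by
    refine .and (.lt (by fun_prop) (by fun_prop))
      (SigmaOne.ex (.and (.and ?_ (.and ?_ ?_)) (.lt (by fun_prop) (by fun_prop))))
    · exact (SigmaOne.of_computable ha).comp
        (f := fun x : (ℕ × ℕ) × ℕ × ℕ × ℕ × ℕ => (x.2.1 + 1, x.2.2.1)) (by fun_prop)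
    · exact (SigmaOne.of_computable hb).comp
        (f := fun x : (ℕ × ℕ) × ℕ × ℕ × ℕ × ℕ => (x.2.1 + 1, x.2.2.2.1)) (by fun_prop)
    · exact (SigmaOne.of_computable hc).comp
        (f := fun x : (ℕ × ℕ) × ℕ × ℕ × ℕ × ℕ => (x.2.1 + 1, x.2.2.2.2)) (by fun_prop)
  refine h.of_iff fun ⟨u, v⟩ => and_congr_right fun hv => ?_
  simp only at hv ⊢
  have hv' : (0 : ℝ) < v := by exact_mod_cast hv
  have key : ∀ n, u * (c n + 1) + v * a n < v * b n ↔ (u : ℝ) / v < -(g n : ℝ) := fun n => by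
    rw [hg]
    push_cast
    rw [← neg_div, div_lt_div_iff₀ hv' (by positivity), ← @Nat.cast_lt ℝ]
    push_cast
    constructor <;> intro h <;> nlinarith
  constructor
  · intro hlt
    have h1 := hlim.eventually (gt_mem_nhds (neg_lt_neg hlt))
    obtain ⟨n, hn, hn1⟩ := (h1.and (eventually_ge_atTop 1)).exists
    obtain ⟨k, rfl⟩ : ∃ k, n = k + 1 := ⟨n - 1, by omega⟩
    exact ⟨(k, _, _, _), ⟨rfl, rfl, rfl⟩, (key (k + 1)).2 (by linarith)⟩
  · rintro ⟨⟨n, A, B, C⟩, ⟨hA, hB, hC⟩, h⟩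
    simp only at hA hB hC h
    subst hA hB hC
    have h1 := (key (n + 1)).1 h
    have h2 := hgT (n + 1) (by omega)
    linarith

end RightLeft

/-! ### Complexity is stable under an error of one unit in the last place. -/

section Approximation

variable {U : List Bool →. List Bool}

/-- Strings of equal length whose binary values differ by at most one have nearly the same
complexity. -/
theorem IsOptimal.exists_H_le_of_binVal_near (hU : IsOptimal U) :
    ∃ c : ℕ, ∀ s s' : List Bool, s.length = s'.length → binVal s ≤ binVal s' + 1 →
      binVal s' ≤ binVal s + 1 → H U s' ≤ H U s + c := by
  -- The values e = 0, 1, 2 encode the differences -1, 0, 1 without subtraction; each is computed by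
  -- its own transformation.
  have h : ∀ e : ℕ, ∃ c : ℕ, ∀ s s' : List Bool, s'.length = s.length →
      binVal s' + 1 = binVal s + e → H U s' ≤ H U s + c := fun e => by
    have hrel : SigmaOne fun y : List Bool × List Bool =>
        y.2.length = y.1.length ∧ binVal y.2 + 1 = binVal y.1 + e :=
      (SigmaOne.eq (by fun_prop) (by fun_prop)).and (SigmaOne.eq (by fun_prop) (by fun_prop))
    obtain ⟨ψ, hψ, hψp, hψd⟩ := SigmaOne.exists_partrec (p := fun s s' : List Bool =>
      s'.length = s.length ∧ binVal s' + 1 = binVal s + e) hrel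
    obtain ⟨c, hc⟩ := hU.exists_H_le_add hψ
    refine ⟨c, fun s s' hl hv => ?_⟩
    obtain ⟨p, hp⟩ := hU.exists_program s
    obtain ⟨t, ht⟩ := Part.dom_iff_mem.1 (hψd s ⟨s', hl, hv⟩)
    obtain ⟨h1, h2⟩ := hψp s t ht
    have : t = s' := binVal_injective (h1.trans hl.symm) (by omega)
    exact hc p s s' hp (this ▸ ht)
  obtain ⟨c0, h0⟩ := h 0
  obtain ⟨c1, h1⟩ := h 1
  obtain ⟨c2, h2⟩ := h 2
  refine ⟨c0 + c1 + c2, fun s s' hl hv hv' => ?_⟩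
  obtain h | h | h : binVal s' + 1 = binVal s + 0 ∨ binVal s' + 1 = binVal s + 1 ∨
      binVal s' + 1 = binVal s + 2 := by omega
  · have := h0 s s' hl.symm h
    omega
  · have := h1 s s' hl.symm h
    omega
  · have := h2 s s' hl.symm h
    omega

/-- If `σ n` is determined up to an error of one unit in the last place by `n` and `m n` further
bits, in a recursively enumerable way, then its complexity is at most `m n + o(n)`. -/
theorem IsOptimal.exists_H_le_of_sigmaOne (hU : IsOptimal U) {m : ℕ → ℕ} (hm : Primrec m)
    {K : ℕ} (hK : 0 < K) {ρ : ℕ × List Bool → List Bool → Prop}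
    (hρ : SigmaOne fun y : (ℕ × List Bool) × List Bool => ρ y.1 y.2) {σ : ℕ → List Bool}
    (h : ∀ᶠ n in atTop, ∃ x : List Bool, x.length = m n ∧ (∃ s, ρ (n, x) s) ∧
      ∀ s, ρ (n, x) s → s.length = (σ n).length ∧ binVal s ≤ binVal (σ n) + 1 ∧
        binVal (σ n) ≤ binVal s + 1) :
    ∃ c : ℕ, ∀ᶠ n in atTop, H U (σ n) ≤ m n + n / K + c := by
  obtain ⟨φ, hφ, hφp, hφd⟩ := hρ.exists_partrec
  obtain ⟨c, hc⟩ := hU.exists_program_length_le hm hK hφ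
  obtain ⟨c', hc'⟩ := hU.exists_H_le_of_binVal_near
  refine ⟨c + c', h.mono fun n => ?_⟩
  rintro ⟨x, hx, hex, hall⟩
  obtain ⟨s, hs⟩ := Part.dom_iff_mem.1 (hφd (n, x) hex)
  obtain ⟨h1, h2, h3⟩ := hall s (hφp _ _ hs)
  obtain ⟨p, hp, hl⟩ := hc n x s hx hs
  have h4 := hc' s (σ n) h1 h2 h3
  have h5 := H_le hp
  omega

end Approximation

/-! ### The consequences of computability of W(Q,T). -/

section FixedPoint

variable {U : List Bool →. List Bool} {Q T : ℝ}

theorem IsOptimal.sigmaOne_gt_of_computableReal_W (hU : IsOptimal U) (hQ : ComputableReal Q)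
    (hQ0 : 0 < Q) (hT0 : 0 < T) (hT1 : T < 1) (hW : ComputableReal (W U Q T)) :
    SigmaOne fun y : ℕ × ℕ => (0 < y.1 ∧ y.1 < y.2) ∧ T < (y.1 : ℝ) / y.2 := by
  have h : SigmaOne fun y : ℕ × ℕ => (0 < y.1 ∧ y.1 < y.2) ∧ ∃ L : List (List Bool),
      (0 < y.1 ∧ 0 < y.2) ∧ HaltList U L ∧
        W U Q T < (L.map fun p => weight Q ((y.1 : ℝ) / y.2) p.length).sum :=
    .and (.and (.lt (by fun_prop) (by fun_prop)) (.lt (by fun_prop) (by fun_prop)))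
      (SigmaOne.ex (hU.sigmaOne_lt_sum hQ hQ0 hW))
  refine h.of_iff fun ⟨u, v⟩ => and_congr_right fun ⟨hu, huv⟩ => ?_
  simp only at hu huv ⊢
  have hu' : (0 : ℝ) < u := by exact_mod_cast hu
  have hv : 0 < v := hu.trans huv
  have hv' : (0 : ℝ) < v := by exact_mod_cast hv
  have hlt1 : (u : ℝ) / v < 1 := by
    rw [div_lt_one hv']
    exact_mod_cast huv
  constructor
  · intro hT
    obtain ⟨F, hF, hlt⟩ := hU.exists_lt_sum_weight Q (by positivity) hlt1
      (hU.W_strictMono Q hT0 hT hlt1)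
    exact ⟨F.toList, ⟨hu, hv⟩, haltList_toList hF,
      by rwa [(haltList_toList hF).sum_eq, Finset.toList_toFinset]⟩
  · rintro ⟨L, -, hL, hlt⟩
    by_contra! hle
    rw [hL.sum_eq] at hlt
    have h1 : ∑ p ∈ L.toFinset, weight Q ((u : ℝ) / v) p.length ≤
        ∑ p ∈ L.toFinset, weight Q T p.length :=
      Finset.sum_le_sum fun p _ => weight_mono Q (by positivity) hle _
    have h2 := hU.sum_weight_le_W Q hT0 hT1 (F := L.toFinset) (by simpa using hL.2)
    linarith

/-- With κ = log₂ C, taking logarithms gives l > T(n - κ) + TQ log₂ l. Dropping the last term bounds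
l below; reinserting that bound into log₂ l gives l - Tn ≥ TQ log₂(T(n - κ)) - Tκ, divergent because
Q > 0. -/
theorem eventually_le_of_weight_lt (hQ0 : 0 < Q) (hT0 : 0 < T) {C : ℝ} (hC : 0 < C) (B : ℝ) :
    ∀ᶠ n : ℕ in atTop, ∀ l : ℕ, 1 ≤ l → weight Q T l < C * (1 / 2) ^ n →
      B ≤ (l : ℝ) - T * n := by
  set κ := Real.logb 2 C
  have hκ : (2 : ℝ) ^ κ = C := Real.rpow_logb two_pos (by norm_num) hC
  have hlim : Tendsto (fun n : ℕ => Real.logb 2 (T * (n - κ))) atTop atTop :=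
    (Real.tendsto_logb_atTop one_lt_two).comp
      ((tendsto_atTop_add_const_right _ (-κ) tendsto_natCast_atTop_atTop).const_mul_atTop hT0)
  filter_upwards [hlim.eventually_ge_atTop ((B + T * κ) / (T * Q)),
    eventually_gt_atTop ⌈max κ 0⌉₊] with n hn hnκ l hl hlt
  have hnκ' : κ < n := (le_max_left _ _).trans_lt (Nat.lt_of_ceil_lt hnκ)
  have hl0 : (0 : ℝ) < l := by exact_mod_cast hl
  have hl1 : (1 : ℝ) ≤ l := by exact_mod_cast hl
  have hmain : Q * Real.logb 2 l - l / T < κ - n := by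
    have h1 : weight Q T l = (2 : ℝ) ^ (Q * Real.logb 2 l - l / T) := by
      rw [weight, sub_eq_add_neg, Real.rpow_add two_pos, mul_comm Q, Real.rpow_mul two_pos.le,
        Real.rpow_logb two_pos (by norm_num) hl0, neg_div]
    have h2 : C * (1 / 2) ^ n = (2 : ℝ) ^ (κ - n) := by
      rw [Real.rpow_sub two_pos, hκ, Real.rpow_natCast, one_div, inv_pow, div_eq_mul_inv]
    rw [h1, h2] at hlt
    exact (Real.rpow_lt_rpow_left_iff one_lt_two).1 hlt
  have hlog0 : 0 ≤ Real.logb 2 l := Real.logb_nonneg one_lt_two hl1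
  have hl2 : T * (n - κ) < l := by
    have : (n : ℝ) - κ < l / T := by nlinarith
    rwa [lt_div_iff₀ hT0, mul_comm] at this
  have hlog : Real.logb 2 (T * (n - κ)) ≤ Real.logb 2 l :=
    Real.logb_le_logb_of_le one_lt_two (mul_pos hT0 (by linarith)) hl2.le
  have h3 := hn.trans hlog
  rw [div_le_iff₀ (by positivity)] at h3
  have h4 : T * (Q * Real.logb 2 l - l / T) < T * (κ - n) := by gcongr
  have h5 : T * (l / T) = l := mul_div_cancel₀ _ hT0.ne'
  nlinarith

theorem eventually_floor_pos (hT0 : 0 < T) : ∀ᶠ n : ℕ in atTop, 0 < ⌊T * 2 ^ n⌋₊ := by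
  have h : Tendsto (fun n : ℕ => T * (2 : ℝ) ^ n) atTop atTop :=
    (tendsto_pow_atTop_atTop_of_one_lt one_lt_two).const_mul_atTop hT0
  filter_upwards [h.eventually_ge_atTop 1] with n hn
  exact Nat.floor_pos.2 hn

theorem eventually_two_pow_lt {ε : ℝ} (hε : 0 < ε) : ∀ᶠ n : ℕ in atTop, (1 / 2 : ℝ) ^ n < ε :=
  (tendsto_pow_atTop_nhds_zero_of_lt_one (by norm_num) (by norm_num)).eventually (gt_mem_nhds hε)

theorem floor_div_le (hT0 : 0 < T) (n : ℕ) : (⌊T * 2 ^ n⌋₊ : ℝ) / 2 ^ n ≤ T := by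
  rw [div_le_iff₀ (by positivity)]
  exact Nat.floor_le (by positivity)

theorem lt_floor_succ_div (T : ℝ) (n : ℕ) : T < ((⌊T * 2 ^ n⌋₊ + 1 : ℕ) : ℝ) / 2 ^ n := by
  rw [lt_div_iff₀ (by positivity)]
  push_cast
  exact Nat.lt_floor_add_one _

theorem IsOptimal.chaitinRandom (hU : IsOptimal U) (hQ : ComputableReal Q) (hQ0 : 0 < Q)
    (hT0 : 0 < T) (hT1 : T < 1) (hW : ComputableReal (W U Q T)) :
    ChaitinRandom U T (binary T) := by
  classical
  set w := W U Q T with hw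
  -- M lists programs with their outputs. The sum is taken at the right end of the dyadic interval
  -- of T_n, strictly above T, so that a finite sum does exceed w. The final bit makes the new
  -- string longer than every listed output.
  have hrel : SigmaOne fun y : List Bool × List Bool => ∃ M : List (List Bool × List Bool),
      ((0 < binVal y.1 + 1 ∧ 0 < 2 ^ y.1.length) ∧ HaltList U (M.map Prod.fst) ∧
        w < ((M.map Prod.fst).map fun p =>
          weight Q (((binVal y.1 + 1 : ℕ) : ℝ) / (2 ^ y.1.length : ℕ)) p.length).sum) ∧
      (∀ e ∈ M, e.2 ∈ U e.1) ∧ y.2 = (M.map Prod.snd).flatten ++ [true] := by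
    refine SigmaOne.ex (.and ?_ (.and ?_ (.eq (by fun_prop) (by fun_prop))))
    · exact (hU.sigmaOne_lt_sum hQ hQ0 hW).comp
        (f := fun y : (List Bool × List Bool) × List (List Bool × List Bool) =>
          ((binVal y.1.1 + 1, 2 ^ y.1.1.length), y.2.map Prod.fst)) (by fun_prop)
    · exact SigmaOne.forall_mem
        (p := fun (_ : (List Bool × List Bool) × List (List Bool × List Bool))
          (e : List Bool × List Bool) => e.2 ∈ U e.1)
        ((SigmaOne.of_partrec hU.1.1).comp Primrec.snd) Primrec.snd
  obtain ⟨ψ, hψ, hψp, hψd⟩ := SigmaOne.exists_partrec (p := fun x s : List Bool =>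
    ∃ M : List (List Bool × List Bool),
      ((0 < binVal x + 1 ∧ 0 < 2 ^ x.length) ∧ HaltList U (M.map Prod.fst) ∧
        w < ((M.map Prod.fst).map fun p =>
          weight Q (((binVal x + 1 : ℕ) : ℝ) / (2 ^ x.length : ℕ)) p.length).sum) ∧
      (∀ e ∈ M, e.2 ∈ U e.1) ∧ s = (M.map Prod.snd).flatten ++ [true]) hrel
  obtain ⟨c, hc⟩ := hU.exists_H_le_add hψ
  obtain ⟨t₀, hTt₀, ht₀⟩ := exists_between hT1
  obtain ⟨C, hC, hLip⟩ := hU.exists_sum_weight_sub_le Q hT0 hTt₀ ht₀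
  refine tendsto_atTop.2 fun B => ?_
  filter_upwards [eventually_le_of_weight_lt hQ0 hT0 hC (B + c),
    eventually_two_pow_lt (sub_pos.2 hTt₀)] with n hB hn
  have hval : binVal (firstBits (binary T) n) = ⌊T * 2 ^ n⌋₊ := binVal_firstBits hT0.le hT1 n
  obtain ⟨t, ht⟩ : ∃ t : ℝ, t = ((⌊T * 2 ^ n⌋₊ + 1 : ℕ) : ℝ) / (2 ^ n : ℕ) := ⟨_, rfl⟩
  have hTt : T < t := by
    rw [ht]
    push_cast
    simpa using lt_floor_succ_div T n
  have htT : t - T ≤ (1 / 2) ^ n := by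
    have := floor_div_le hT0 n
    rw [ht]
    push_cast
    rw [add_div, one_div_pow]
    linarith
  have htt₀ : t ≤ t₀ := by linarith
  have hdom : (ψ (firstBits (binary T) n)).Dom := by
    refine hψd _ ?_
    obtain ⟨F, hF, hlt⟩ := hU.exists_lt_sum_weight Q (hT0.trans hTt) (htt₀.trans_lt ht₀)
      (hU.W_strictMono Q hT0 hTt (htt₀.trans_lt ht₀))
    have hF' : ∀ p, ∃ s, p ∈ F → s ∈ U p := fun p => by
      by_cases hp : p ∈ F
      · obtain ⟨s, hs⟩ := (PFun.mem_dom _ _).1 (hF p hp)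
        exact ⟨s, fun _ => hs⟩
      · exact ⟨[], fun h => absurd h hp⟩
    choose out hout using hF'
    have hmap : (F.toList.map fun p => (p, out p)).map Prod.fst = F.toList := by
      simp [Function.comp_def]
    refine ⟨_, F.toList.map fun p => (p, out p), ⟨⟨by positivity, by positivity⟩, ?_, ?_⟩, ?_, rfl⟩
    · rw [hmap]
      exact haltList_toList hF
    · rw [hmap, (haltList_toList hF).sum_eq, Finset.toList_toFinset, hval, length_firstBits, ← ht]
      exact hlt
    · intro e he
      obtain ⟨p, hp, rfl⟩ := List.mem_map.1 he
      exact hout p (by simpa using hp)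
  obtain ⟨s, hs⟩ := Part.dom_iff_mem.1 hdom
  obtain ⟨M, ⟨-, hM, hlt⟩, hMU, hsM⟩ := hψp _ _ hs
  rw [hM.sum_eq, hval, length_firstBits, ← ht] at hlt
  set F := (M.map Prod.fst).toFinset with hFdef
  have hF : ∀ p ∈ F, p ∈ U.Dom := fun p hp => hM.2 p (List.mem_toFinset.1 hp)
  obtain ⟨q, hq⟩ := hU.exists_program (firstBits (binary T) n)
  obtain ⟨p', hp'⟩ := hU.exists_program s
  obtain ⟨p, hp, hpl⟩ := exists_length_eq_H hp'
  have hpF : p ∉ F := by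
    intro hpF
    obtain ⟨e, he, rfl⟩ := List.mem_map.1 (List.mem_toFinset.1 hpF)
    have hes : e.2 = s := Part.mem_unique (hMU e he) hp
    have := (List.sublist_flatten_of_mem (List.mem_map_of_mem (f := Prod.snd) he)).length_le
    rw [hes, hsM] at this
    simp at this
  -- Since p is outside F, its weight fits into w minus the sum of F at T, which the Lipschitz bound
  -- makes less than C 2^(-n).
  have h1 := hU.sum_weight_le_W Q hT0 hT1 (F := insert p F) fun p' hp' => by
    rcases Finset.mem_insert.1 hp' with rfl | hp'
    exacts [mem_dom hp, hF _ hp']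
  rw [Finset.sum_insert hpF] at h1
  have h2 := hLip F hF t hTt.le htt₀
  have h3 : C * (t - T) ≤ C * (1 / 2) ^ n := by gcongr
  have h4 := hB p.length (hU.one_le_length (mem_dom hp)) (by linarith)
  have h5 : ((H U s : ℕ) : ℝ) ≤ H U (firstBits (binary T) n) + c := by
    exact_mod_cast hc q _ s hq hs
  rw [hpl] at h4
  linarith

theorem IsOptimal.exists_H_firstBits_le (hU : IsOptimal U) (hQ : ComputableReal Q) (hQ0 : 0 < Q)
    (hT0 : 0 < T) (hT1 : T < 1) (hW : ComputableReal (W U Q T)) {a d : ℕ}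
    (har : T < (a : ℝ) / (d + 1)) (har1 : (a : ℝ) / (d + 1) < 1) {K : ℕ} (hK : 0 < K) :
    ∃ c : ℕ, ∀ᶠ n in atTop,
      H U (firstBits (binary T) n) ≤ (a * n / (d + 1) + 1) + n / K + c := by
  classical
  set w := W U Q T with hw
  obtain ⟨q, hq⟩ := hU.exists_mem_dom
  obtain ⟨T', hTT', hT'r⟩ := exists_between har
  have hT'0 : 0 < T' := hT0.trans hTT'
  obtain ⟨C, hC, htail⟩ := hU.exists_W_le_sum_add Q hT0 hTT' (hT'r.trans har1)
  -- Here y.2 holds the bits of the halting probability. The sums at i and i + 2 must straddle w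
  -- strictly; the point between is left free because its comparison with w is not guaranteed. The
  -- fixed program q heads every list so that the growth rate γ does not depend on L.
  let ρ : ℕ × List Bool → List Bool → Prop := fun y s => ∃ L : List (List Bool),
    s.length = y.1 ∧
    ((binVal y.2 : ℕ) : ℝ) / 2 ^ y.2.length <
      ((q :: L).map fun p => (1 / 2 : ℝ) ^ p.length).sum ∧
    ((0 < binVal s ∧ 0 < 2 ^ y.1) ∧ HaltList U (q :: L) ∧
      ((q :: L).map fun p =>
        weight Q (((binVal s : ℕ) : ℝ) / (2 ^ y.1 : ℕ)) p.length).sum < w) ∧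
    ((0 < binVal s + 2 ∧ 0 < 2 ^ y.1) ∧ HaltList U (q :: L) ∧
      w < ((q :: L).map fun p =>
        weight Q (((binVal s + 2 : ℕ) : ℝ) / (2 ^ y.1 : ℕ)) p.length).sum)
  have hρ : SigmaOne fun y : (ℕ × List Bool) × List Bool => ρ y.1 y.2 := by
    refine SigmaOne.ex (.and (.eq (by fun_prop) (by fun_prop)) (.and ?_ (.and ?_ ?_)))
    · exact sigmaOne_lt_sum_two_pow.comp
        (f := fun y : ((ℕ × List Bool) × List Bool) × List (List Bool) =>
          ((binVal y.1.1.2, y.1.1.2.length), q :: y.2)) (by fun_prop)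
    · exact (hU.sigmaOne_sum_lt hQ hQ0 hW).comp
        (f := fun y : ((ℕ × List Bool) × List Bool) × List (List Bool) =>
          ((binVal y.1.2, 2 ^ y.1.1.1), q :: y.2)) (by fun_prop)
    · exact (hU.sigmaOne_lt_sum hQ hQ0 hW).comp
        (f := fun y : ((ℕ × List Bool) × List Bool) × List (List Bool) =>
          ((binVal y.1.2 + 2, 2 ^ y.1.1.1), q :: y.2)) (by fun_prop)
  refine hU.exists_H_le_of_sigmaOne (m := fun n => a * n / (d + 1) + 1) (by fun_prop) hK hρ ?_
  have hql := hU.one_le_length hq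
  set γ := weight Q T q.length * Real.log 2 with hγ
  have hγ0 : 0 < γ := mul_pos (weight_pos Q T hql) (Real.log_pos one_lt_two)
  have hδ : 0 < (a : ℝ) / (d + 1) / T' - 1 := by
    rw [sub_pos, lt_div_iff₀ hT'0]
    linarith
  -- The tail decays like 2^(-rn/T') with r = a / (d + 1) > T', so it is eventually below the growth
  -- γ 2^(-n) of the sum over one dyadic step.
  have hlim : ∀ᶠ n : ℕ in atTop,
      C * (2 : ℝ) ^ (-(((a * n / (d + 1) + 1 : ℕ) : ℝ)) / T') < γ * (1 / 2) ^ n := by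
    have h1 : Tendsto (fun n : ℕ => ((2 : ℝ) ^ (-((a : ℝ) / (d + 1) / T' - 1))) ^ n) atTop
        (nhds 0) := tendsto_pow_atTop_nhds_zero_of_lt_one (by positivity)
          (Real.rpow_lt_one_of_one_lt_of_neg one_lt_two (by linarith))
    filter_upwards [h1.eventually (gt_mem_nhds (div_pos hγ0 hC))] with n hn
    have h2 : (a : ℝ) / (d + 1) * n ≤ ((a * n / (d + 1) + 1 : ℕ) : ℝ) := by
      have := Nat.lt_floor_add_one (((a * n : ℕ) : ℝ) / ((d + 1 : ℕ) : ℝ))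
      rw [Nat.floor_div_eq_div] at this
      push_cast at this ⊢
      rw [div_mul_eq_mul_div]
      exact this.le
    have h3 : (2 : ℝ) ^ (-(((a * n / (d + 1) + 1 : ℕ) : ℝ)) / T') ≤
        ((2 : ℝ) ^ (-((a : ℝ) / (d + 1) / T' - 1))) ^ n * (1 / 2) ^ n := by
      have h4 : (1 / 2 : ℝ) ^ n = (2 : ℝ) ^ (-(n : ℝ)) := by
        rw [Real.rpow_neg two_pos.le, Real.rpow_natCast, one_div, inv_pow]
      rw [h4, ← Real.rpow_natCast, ← Real.rpow_mul two_pos.le, ← Real.rpow_add two_pos]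
      refine Real.rpow_le_rpow_of_exponent_le one_le_two ?_
      calc -(((a * n / (d + 1) + 1 : ℕ) : ℝ)) / T' ≤ -((a : ℝ) / (d + 1) * n) / T' := by gcongr
        _ = _ := by ring
    rw [lt_div_iff₀ hC] at hn
    calc C * (2 : ℝ) ^ (-(((a * n / (d + 1) + 1 : ℕ) : ℝ)) / T')
        ≤ C * (((2 : ℝ) ^ (-((a : ℝ) / (d + 1) / T' - 1))) ^ n * (1 / 2) ^ n) := by gcongr
      _ = ((2 : ℝ) ^ (-((a : ℝ) / (d + 1) / T' - 1))) ^ n * C * (1 / 2) ^ n := by ring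
      _ < _ := by gcongr
  filter_upwards [hlim, eventually_floor_pos hT0, eventually_two_pow_lt (sub_pos.2 hT1)]
    with n hn hfl hn1
  have hval : binVal (firstBits (binary T) n) = ⌊T * 2 ^ n⌋₊ := binVal_firstBits hT0.le hT1 n
  set i₀ := ⌊T * 2 ^ n⌋₊ with hi₀
  obtain ⟨m, hm⟩ : ∃ m, m = a * n / (d + 1) + 1 := ⟨_, rfl⟩
  simp only [← hm] at hn ⊢
  obtain ⟨X, hXlt, ⟨F, hF, hFX⟩, hX⟩ := hU.exists_approx_halting m
  obtain ⟨x, hxl, hxX⟩ := exists_binVal_eq hXlt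
  have hle : (i₀ : ℝ) / 2 ^ n ≤ T := floor_div_le hT0 n
  have hi₀pos : (0 : ℝ) < i₀ := by exact_mod_cast hfl
  -- Up to i₀ the point is at most T and a finite sum stays below w. From i₀ + 2 on it is at least T
  -- + 2^(-n), where growth beats the missing tail. Only i₀ + 1 is undetermined.
  have hcut : ∀ L : List (List Bool), HaltList U (q :: L) →
      ((binVal x : ℕ) : ℝ) / 2 ^ x.length <
        ((q :: L).map fun p => (1 / 2 : ℝ) ^ p.length).sum →
      (∀ i : ℕ, 0 < i → i ≤ i₀ →
        ((q :: L).map fun p => weight Q ((i : ℝ) / (2 ^ n : ℕ)) p.length).sum < w) ∧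
      (∀ i : ℕ, i₀ + 2 ≤ i →
        w < ((q :: L).map fun p => weight Q ((i : ℝ) / (2 ^ n : ℕ)) p.length).sum) := by
    intro L hL hLX
    rw [hL.sum_eq, hxX, hxl] at hLX
    have hLdom : ∀ p ∈ (q :: L).toFinset, p ∈ U.Dom := fun p hp => hL.2 p (List.mem_toFinset.1 hp)
    have hqL : q ∈ (q :: L).toFinset := by simp
    constructor
    · intro i hi hii
      rw [hL.sum_eq]
      have hi' : (0 : ℝ) < i := by exact_mod_cast hi
      have hiT : (i : ℝ) / (2 ^ n : ℕ) ≤ T := by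
        push_cast
        refine le_trans ?_ hle
        gcongr
      refine lt_of_le_of_lt (Finset.sum_le_sum fun p _ => weight_mono Q (by positivity) hiT _)
        (hU.sum_weight_lt_W Q hT0 hT1 hLdom)
    · intro i hii
      rw [hL.sum_eq]
      have h1 : T + (1 / 2) ^ n ≤ (i : ℝ) / (2 ^ n : ℕ) := by
        have h2 : T * 2 ^ n < i₀ + 1 := Nat.lt_floor_add_one _
        have h3 : (i₀ : ℝ) + 2 ≤ i := by exact_mod_cast hii
        push_cast
        rw [le_div_iff₀ (by positivity), add_mul, ← mul_pow]
        norm_num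
        linarith
      have hhalf : (0 : ℝ) < (1 / 2) ^ n := by positivity
      have hstep : ∑ p ∈ (q :: L).toFinset, weight Q T p.length + γ * (1 / 2) ^ n ≤
          ∑ p ∈ (q :: L).toFinset, weight Q (T + (1 / 2) ^ n) p.length := by
        rw [← Finset.add_sum_erase _ _ hqL, ← Finset.add_sum_erase _ _ hqL]
        have h4 := le_weight_sub Q hT0 (t := T + (1 / 2) ^ n) (by linarith) (by linarith) hql
        have h5 : ∑ p ∈ (q :: L).toFinset.erase q, weight Q T p.length ≤
            ∑ p ∈ (q :: L).toFinset.erase q, weight Q (T + (1 / 2) ^ n) p.length :=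
          Finset.sum_le_sum fun p _ => weight_mono Q hT0 (by linarith) _
        rw [add_sub_cancel_left] at h4
        linarith
      have h6 : ∑ p ∈ (q :: L).toFinset, weight Q (T + (1 / 2) ^ n) p.length ≤
          ∑ p ∈ (q :: L).toFinset, weight Q ((i : ℝ) / (2 ^ n : ℕ)) p.length :=
        Finset.sum_le_sum fun p _ => weight_mono Q (by linarith) h1 _
      have h7 := htail (q :: L).toFinset m hLdom fun G hG hd => hX _ G hLdom hG hd hLX
      linarith
  refine ⟨x, hxl, ⟨firstBits (binary T) n, (F.erase q).toList, length_firstBits _ _, ?_⟩, ?_⟩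
  · have hL : HaltList U (q :: (F.erase q).toList) := by
      refine ⟨List.nodup_cons.2 ⟨by simp, Finset.nodup_toList _⟩, fun p hp => ?_⟩
      rcases List.mem_cons.1 hp with rfl | hp
      · exact hq
      · exact hF p (Finset.mem_of_mem_erase (Finset.mem_toList.1 hp))
    have hsum : ((binVal x : ℕ) : ℝ) / 2 ^ x.length <
        ((q :: (F.erase q).toList).map fun p => (1 / 2 : ℝ) ^ p.length).sum := by
      rw [hL.sum_eq, hxX, hxl]
      refine hFX.trans_le (Finset.sum_le_sum_of_subset_of_nonneg (fun p hp => ?_)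
        fun _ _ _ => by positivity)
      by_cases h : p = q <;> simp [h, hp]
    obtain ⟨h1, h2⟩ := hcut _ hL hsum
    rw [hval]
    exact ⟨hsum, ⟨⟨hfl, by positivity⟩, hL, h1 _ hfl le_rfl⟩,
      ⟨⟨by positivity, by positivity⟩, hL, h2 _ le_rfl⟩⟩
  · rintro s ⟨L, hsl, hsum, ⟨⟨hs0, -⟩, hL, hlo⟩, ⟨-, -, hhi⟩⟩
    obtain ⟨h1, h2⟩ := hcut _ hL hsum
    refine ⟨by simpa using hsl, ?_, ?_⟩
    · by_contra! h
      exact absurd (h2 (binVal s) (by omega)) (not_lt.2 hlo.le)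
    · by_contra! h
      exact absurd (h1 (binVal s + 2) (by omega) (by omega)) (not_lt.2 hhi.le)

theorem IsOptimal.compressible (hU : IsOptimal U) (hQ : ComputableReal Q) (hQ0 : 0 < Q)
    (hT0 : 0 < T) (hT1 : T < 1) (hW : ComputableReal (W U Q T)) :
    Compressible U T (binary T) := by
  refine ⟨fun n => max ((H U (firstBits (binary T) n) : ℝ) - T * n) 0, ?_, fun n _ => by
    linarith [le_max_left ((H U (firstBits (binary T) n) : ℝ) - T * n) 0]⟩
  rw [isLittleO_iff]
  intro ε hε
  -- The budget ε is split in three: the excess of the rational over T, the rate 1 / (K + 1) of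
  -- coding n, and the additive constants.
  obtain ⟨a, d, har, har'⟩ := exists_nat_div_btwn hT0.le
    (lt_min (by linarith : T < T + ε / 3) hT1)
  obtain ⟨K, hK⟩ := exists_nat_one_div_lt (by positivity : 0 < ε / 3)
  obtain ⟨c, hc⟩ := hU.exists_H_firstBits_le hQ hQ0 hT0 hT1 hW har
    (har'.trans_le (min_le_right _ _)) K.succ_pos
  have hlim : ∀ᶠ n : ℕ in atTop, 3 * ((c : ℝ) + 1) / ε ≤ n :=
    tendsto_natCast_atTop_atTop.eventually_ge_atTop _
  filter_upwards [hc, hlim] with n hn hnc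
  have h1 : ((a * n / (d + 1) : ℕ) : ℝ) ≤ (a : ℝ) / (d + 1) * n := by
    refine Nat.cast_div_le.trans_eq ?_
    push_cast
    ring
  have h2 : ((n / K.succ : ℕ) : ℝ) ≤ 1 / ((K : ℝ) + 1) * n := by
    refine Nat.cast_div_le.trans_eq ?_
    push_cast
    ring
  have h3 : (H U (firstBits (binary T) n) : ℝ) ≤
      (((a * n / (d + 1) : ℕ) : ℝ) + 1) + ((n / K.succ : ℕ) : ℝ) + c := by exact_mod_cast hn
  have h4 : (a : ℝ) / (d + 1) * n ≤ (T + ε / 3) * n := by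
    have := har'.le.trans (min_le_left _ _)
    gcongr
  have h5 : 1 / ((K : ℝ) + 1) * n ≤ ε / 3 * n := by gcongr
  rw [div_le_iff₀ hε] at hnc
  rw [Real.norm_of_nonneg (le_max_right _ _), Real.norm_of_nonneg (by positivity)]
  exact max_le (by nlinarith) (by positivity)

theorem IsOptimal.not_leftComputable (hU : IsOptimal U) (hT0 : 0 < T) (hT1 : T < 1)
    (hright : SigmaOne fun y : ℕ × ℕ => (0 < y.1 ∧ y.1 < y.2) ∧ T < (y.1 : ℝ) / y.2)
    (hrand : ChaitinRandom U T (binary T)) : ¬ LeftComputable T := by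
  intro hleft
  -- The lower test is relaxed by one unit because T may equal its n-bit truncation; when the value
  -- is 0, truncated subtraction gives 0 < T. The bound by 2^n reflects that the right cut only
  -- covers fractions below 1, and it holds for the true prefix once 2^(-n) < 1 - T.
  have hρ : SigmaOne fun y : (ℕ × List Bool) × List Bool => y.2.length = y.1.1 ∧
      (0 < 2 ^ y.1.1 ∧ ((binVal y.2 - 1 : ℕ) : ℝ) / (2 ^ y.1.1 : ℕ) < T) ∧
      (0 < binVal y.2 + 1 ∧ binVal y.2 + 1 < 2 ^ y.1.1) ∧
        T < ((binVal y.2 + 1 : ℕ) : ℝ) / (2 ^ y.1.1 : ℕ) := by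
    refine .and (.eq (by fun_prop) (by fun_prop)) (.and ?_ ?_)
    · exact hleft.sigmaOne_lt.comp (f := fun y : (ℕ × List Bool) × List Bool =>
        (binVal y.2 - 1, 2 ^ y.1.1)) (by fun_prop)
    · exact hright.comp (f := fun y : (ℕ × List Bool) × List Bool =>
        (binVal y.2 + 1, 2 ^ y.1.1)) (by fun_prop)
  -- Coding n at a rate below T, with no further bits, bounds H(T_n) by Tn + c, contradicting
  -- randomness.
  obtain ⟨K, hK⟩ := exists_nat_one_div_lt hT0
  obtain ⟨c, hc⟩ := hU.exists_H_le_of_sigmaOne (m := fun _ => 0) (by fun_prop) K.succ_pos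
    (ρ := fun y s => s.length = y.1 ∧
      (0 < 2 ^ y.1 ∧ ((binVal s - 1 : ℕ) : ℝ) / (2 ^ y.1 : ℕ) < T) ∧
      (0 < binVal s + 1 ∧ binVal s + 1 < 2 ^ y.1) ∧
        T < ((binVal s + 1 : ℕ) : ℝ) / (2 ^ y.1 : ℕ)) hρ
    (σ := firstBits (binary T)) (by
      filter_upwards [eventually_two_pow_lt (sub_pos.2 hT1)] with n hn
      have hval : binVal (firstBits (binary T) n) = ⌊T * 2 ^ n⌋₊ := binVal_firstBits hT0.le hT1 n
      have h2n : (0 : ℝ) < 2 ^ n := by positivity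
      have hfl : (⌊T * 2 ^ n⌋₊ : ℝ) ≤ T * 2 ^ n := Nat.floor_le (by positivity)
      refine ⟨[], rfl, ⟨firstBits (binary T) n, length_firstBits _ _, ⟨by positivity, ?_⟩,
        ⟨by positivity, ?_⟩, ?_⟩, ?_⟩
      · rw [hval]
        push_cast
        rw [div_lt_iff₀ h2n]
        rcases Nat.eq_zero_or_pos ⌊T * 2 ^ n⌋₊ with h | h
        · rw [h]
          simpa using hT0
        · rw [Nat.cast_sub h]
          push_cast
          linarith
      · rw [hval]
        have : (⌊T * 2 ^ n⌋₊ : ℝ) + 1 < 2 ^ n := by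
          have h1 : (1 / 2 : ℝ) ^ n * 2 ^ n = 1 := by rw [← mul_pow]; norm_num
          nlinarith
        exact_mod_cast this
      · rw [hval]
        push_cast
        simpa using lt_floor_succ_div T n
      · rintro s ⟨hsl, ⟨-, hlo⟩, -, hhi⟩
        push_cast at hlo hhi
        rw [div_lt_iff₀ h2n] at hlo
        rw [lt_div_iff₀ h2n] at hhi
        refine ⟨by simpa using hsl, ?_, ?_⟩
        · rw [hval]
          have : binVal s - 1 ≤ ⌊T * 2 ^ n⌋₊ := Nat.le_floor hlo.le
          omega
        · rw [hval]
          have : ⌊T * 2 ^ n⌋₊ < binVal s + 1 :=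
            (Nat.floor_lt (by positivity)).2 (by push_cast; exact hhi)
          omega)
  have hlim : ∀ᶠ n : ℕ in atTop, (1 : ℝ) + c ≤ H U (firstBits (binary T) n) - T * n :=
    hrand.eventually_ge_atTop _
  obtain ⟨n, hn, hn'⟩ := (hc.and hlim).exists
  have h2 : ((n / K.succ : ℕ) : ℝ) ≤ 1 / ((K : ℝ) + 1) * n := by
    refine Nat.cast_div_le.trans_eq ?_
    push_cast
    ring
  have h3 : (H U (firstBits (binary T) n) : ℝ) ≤ ((0 : ℕ) : ℝ) + ((n / K.succ : ℕ) : ℝ) + c := by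
    exact_mod_cast hn
  have h4 : 1 / ((K : ℝ) + 1) * n ≤ T * n := by gcongr
  push_cast at h3
  linarith

end FixedPoint

end AIT

theorem theorem5p2 (U : List Bool →. List Bool) (hU : AIT.IsOptimal U)
    (Q : ℝ) (hQ : AIT.ComputableReal Q) (hQ0 : 0 < Q)
    (T : ℝ) (hT0 : 0 < T) (hT1 : T < 1) (hW : AIT.ComputableReal (AIT.W U Q T)) :
    (AIT.RightComputable T ∧ ¬ AIT.LeftComputable T) ∧
      (AIT.ChaitinRandom U T (AIT.binary T) ∧ AIT.Compressible U T (AIT.binary T)) := by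
  have hright := hU.sigmaOne_gt_of_computableReal_W hQ hQ0 hT0 hT1 hW
  have hrand := hU.chaitinRandom hQ hQ0 hT0 hT1 hW
  exact ⟨⟨AIT.rightComputable_of_sigmaOne hT0 hT1 hright,
    hU.not_leftComputable hT0 hT1 hright hrand⟩, hrand,
    hU.compressible hQ hQ0 hT0 hT1 hW⟩
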